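/- Fix an infinite set of propositional variables and the signature $\top,\bot$ (constants), $\neg$ (unary), $\wedge,\vee$ (binary). A \emph{logic} is a set of rules $\Gamma\vdash\varphi$ ($\Gamma$ an arbitrary set of formulas, $\varphi$ a formula) which is reflexive ($\varphi\vdash\varphi$), monotone, closed under cut and closed under substitutions. Logics are ordered by inclusion (if $L\le L'$, then $L'$ is an \emph{extension} of $L$); this is a complete lattice, with meet the intersection and join $\vee$ the least common extension, and its top is the \emph{trivial} logic, in which all rules hold. For $L\le L'$, $[L,L']$ is the set of all logics between $L$ and $L'$. The logic of a matrix (an algebra with a set of designated values) consists of the rules $\Gamma\vdash\varphi$ such that each valuation designating every formula of $\Gamma$ designates $\varphi$. Let $DM_4$ be the four-element De Morgan lattice with two incomparable elements, both fixed by $\neg$, and let $K_3=\{0<\tfrac12<1\}$ with $\neg x=1-x$. Define: - $BD$, $ETL$: the logics of $DM_4$ with designated set $\{\top,b\}$, where $b$ is one of the two fixpoints of $\neg$, and $\{\top\}$, respectively; - $LP$, $K$: the logics of $K_3$ with designated set $\{\tfrac12,1\}$ and $\{1\}$, respectively; $CL$: classical logic, i.e. the logic of the two-element Boolean algebra with designated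 set $\{1\}$; $KO=LP\cap K$; - $K^-$: the logic of the eight-element De Morgan lattice $\{0,1,2\}^2\setminus\{(0,2)\}$ (componentwise order) with $\neg(x,y)=(2-y,2-x)$ and designated set $\{(2,2)\}$; $KO^-=LP\cap K^-$; - $ECQ$: the extension of $BD$ by the rule $p,\neg p\vdash q$; $ETL_2$: the extension of $ETL$ by the rule $(p\wedge\neg p)\vee(q\wedge\neg q)\vdash r$. **Theorem.** 1. The interval $[ETL,CL]$ has the structure $ETL<[ETL_2,K^-]<K<CL$: one has $ETL<ETL_2\le K^-<K<CL$, $CL$ is non-trivial, $[ETL,CL]=\{ETL\}\cup[ETL_2,K^-]\cup\{K,CL\}$, and every non-trivial extension of $ETL$ other than $ETL$, $K$ and $CL$ lies in $[ETL_2,K^-]$. Hence $ETL_2$ is the unique cover of $ETL$ in the lattice of extensions of $ETL$, and $K^-$ is the unique lower cover of $K$ within $[ETL,CL]$. 2. The interval $[KO^-,CL]$ is the disjoint union of the intervals $[LP,CL]$, $[KO,K]$ and $[KO^-,K^-]$, and each of these is a three-element chain: $$[LP,CL]=\{LP<LP\vee ECQ<CL\},\quad [KO,K]=\{KO<KO\vee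 ECQ<K\},\quad [KO^-,K^-]=\{KO^-<KO^-\vee ECQ<K^-\}.$$ 3. Each non-trivial proper extension of $BD$ lies in one of the pairwise disjoint intervals $[KO,CL]$, $[LP\cap ECQ,KO^-]$, $[ECQ,KO^-\vee ECQ]$, $[ETL,K^-]$. -/

import Mathlib

namespace SuperBelnap

/-- Formulas over the atoms `V` in the signature `⊤, ⊥, ¬, ∧, ∨` (the absolutely free algebra). -/
inductive Formula (V : Type*) : Type _
  | atom : V → Formula V
  | verum : Formula V
  | falsum : Formula V
  | neg : Formula V → Formula V
  | and : Formula V → Formula V → Formula V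
  | or : Formula V → Formula V → Formula V

/-- The extension of a map on atoms to a substitution (an endomorphism of the formula algebra). -/
def Formula.subst {V : Type*} (σ : V → Formula V) : Formula V → Formula V
  | .atom p => σ p
  | .verum => .verum
  | .falsum => .falsum
  | .neg φ => .neg (φ.subst σ)
  | .and φ ψ => .and (φ.subst σ) (ψ.subst σ)
  | .or φ ψ => .or (φ.subst σ) (ψ.subst σ)

/-- A logic: a set of rules `Γ ⊢ φ` (with `Γ` an arbitrary set of formulas) which is reflexive,
monotone, structural and closed under cut. -/
@[ext]
structure Logic (V : Type*) where
  Entails : Set (Formula V) → Formula V → Prop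
  refl : ∀ φ, Entails {φ} φ
  mono : ∀ Γ Δ φ, Entails Γ φ → Entails (Γ ∪ Δ) φ
  cut : ∀ Γ Δ φ, (∀ δ ∈ Δ, Entails Γ δ) → Entails Δ φ → Entails Γ φ
  struct : ∀ Γ φ (σ : V → Formula V), Entails Γ φ →
    Entails (Formula.subst σ '' Γ) (φ.subst σ)

namespace Logic

variable {V : Type*}

/-- `L ≤ L'` means that `L'` is an extension of `L`: each rule of `L` holds in `L'`. -/
instance : PartialOrder (Logic V) where
  le L L' := ∀ Γ φ, L.Entails Γ φ → L'.Entails Γ φ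
  le_refl _ _ _ h := h
  le_trans _ _ _ h h' Γ φ k := h' Γ φ (h Γ φ k)
  le_antisymm L L' h h' := by
    ext Γ φ
    exact ⟨h Γ φ, h' Γ φ⟩

/-- The infimum of a family of logics is their intersection. -/
instance : InfSet (Logic V) where
  sInf S :=
    { Entails := fun Γ φ => ∀ L ∈ S, L.Entails Γ φ
      refl := fun φ L _ => L.refl φ
      mono := fun Γ Δ φ h L hL => L.mono Γ Δ φ (h L hL)
      cut := fun Γ Δ φ h k L hL => L.cut Γ Δ φ (fun δ hδ => h δ hδ L hL) (k L hL)
      struct := fun Γ φ σ h L hL => L.struct Γ φ σ (h L hL) }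

/-- The intersection of two logics. -/
def inter (L L' : Logic V) : Logic V where
  Entails Γ φ := L.Entails Γ φ ∧ L'.Entails Γ φ
  refl φ := ⟨L.refl φ, L'.refl φ⟩
  mono Γ Δ φ h := ⟨L.mono Γ Δ φ h.1, L'.mono Γ Δ φ h.2⟩
  cut Γ Δ φ h k :=
    ⟨L.cut Γ Δ φ (fun δ hδ => (h δ hδ).1) k.1, L'.cut Γ Δ φ (fun δ hδ => (h δ hδ).2) k.2⟩
  struct Γ φ σ h := ⟨L.struct Γ φ σ h.1, L'.struct Γ φ σ h.2⟩

/-- The trivial logic, in which all rules hold. -/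
def trivialLogic : Logic V where
  Entails _ _ := True
  refl _ := True.intro
  mono _ _ _ _ := True.intro
  cut _ _ _ _ _ := True.intro
  struct _ _ _ _ := True.intro

/-- Logics form a complete lattice: `⊓` is intersection, `⊔` is the least common extension, and `⊤`
is the trivial logic. The interval above a logic `B` is the lattice of extensions of `B`. -/
instance : CompleteLattice (Logic V) where
  __ := completeLatticeOfInf (Logic V) fun _ =>
    ⟨fun L hL _ _ h => h L hL, fun _ hL' Γ φ h _ hL => hL' hL Γ φ h⟩
  inf := inter
  inf_le_left _ _ _ _ h := h.1
  inf_le_right _ _ _ _ h := h.2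
  le_inf _ _ _ h h' Γ φ k := ⟨h Γ φ k, h' Γ φ k⟩
  top := trivialLogic
  le_top _ _ _ _ := True.intro

/-- The extension of `B` by a set `ρ` of rules: the least logic above `B` validating `ρ`. -/
def extend (B : Logic V) (ρ : Set (Set (Formula V) × Formula V)) : Logic V :=
  sInf {L | B ≤ L ∧ ∀ r ∈ ρ, L.Entails r.1 r.2}

end Logic

/-- A logical matrix: an algebra in the signature `⊤, ⊥, ¬, ∧, ∨` with a set of designated values. -/
structure LogicalMatrix where
  Carrier : Type
  verum : Carrier
  falsum : Carrier
  neg : Carrier → Carrier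
  and : Carrier → Carrier → Carrier
  or : Carrier → Carrier → Carrier
  designated : Set Carrier

namespace LogicalMatrix

/-- The valuation (homomorphism from the formula algebra) determined by its values on atoms. -/
def eval {V : Type*} (M : LogicalMatrix) (v : V → M.Carrier) : Formula V → M.Carrier
  | .atom p => v p
  | .verum => M.verum
  | .falsum => M.falsum
  | .neg φ => M.neg (M.eval v φ)
  | .and φ ψ => M.and (M.eval v φ) (M.eval v ψ)
  | .or φ ψ => M.or (M.eval v φ) (M.eval v ψ)

theorem eval_subst {V : Type*} (M : LogicalMatrix) (v : V → M.Carrier) (σ : V → Formula V)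
    (φ : Formula V) : M.eval v (φ.subst σ) = M.eval (fun p => M.eval v (σ p)) φ := by
  induction φ with
  | atom p => rfl
  | verum => rfl
  | falsum => rfl
  | neg φ ih => simp only [Formula.subst, eval, ih]
  | and φ ψ ih ih' => simp only [Formula.subst, eval, ih, ih']
  | or φ ψ ih ih' => simp only [Formula.subst, eval, ih, ih']

/-- The logic determined by a matrix: `Γ ⊢ φ` holds iff each valuation which designates all of `Γ`
designates `φ`. -/
def log (V : Type*) (M : LogicalMatrix) : Logic V where
  Entails Γ φ := ∀ v : V → M.Carrier,
    (∀ γ ∈ Γ, M.eval v γ ∈ M.designated) → M.eval v φ ∈ M.designated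
  refl φ _ h := h φ rfl
  mono _ _ _ h v k := h v fun γ hγ => k γ (Or.inl hγ)
  cut _ _ _ h k v l := k v fun δ hδ => h δ hδ v l
  struct Γ φ σ h v k := by
    rw [eval_subst]
    refine h _ fun γ hγ => ?_
    rw [← eval_subst]
    exact k _ ⟨γ, hγ, rfl⟩

/-- The two-element Boolean algebra with the designated set `{⊤}`. -/
def B2 : LogicalMatrix where
  Carrier := Bool
  verum := true
  falsum := false
  neg x := !x
  and x y := x ⊓ y
  or x y := x ⊔ y
  designated := {true}

/-- The three-element chain `0 < 1 < 2` with its order-inverting involution, and the designated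
set `F`. -/
def chain3 (F : Set (Fin 3)) : LogicalMatrix where
  Carrier := Fin 3
  verum := 2
  falsum := 0
  neg x := x.rev
  and x y := x ⊓ y
  or x y := x ⊔ y
  designated := F

/-- The four-element diamond with the order-inverting involution which fixes the two incomparable
elements `(true, false)` and `(false, true)`, and the designated set `F`. -/
def DM4 (F : Set (Bool × Bool)) : LogicalMatrix where
  Carrier := Bool × Bool
  verum := (true, true)
  falsum := (false, false)
  neg x := (!x.2, !x.1)
  and x y := x ⊓ y
  or x y := x ⊔ y
  designated := F

/-- The eight-element matrix which determines `K⁻`. Its lattice is the sublattice of the square of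
the chain `0 < 1 < 2` obtained by removing the corner `(0, 2)`; negation is
`(x, y) ↦ (2 - y, 2 - x)`, which fixes `(2, 0)` and `(1, 1)`, and only the top is designated. -/
def M8 : LogicalMatrix where
  Carrier := {x : Fin 3 × Fin 3 // x ≠ (0, 2)}
  verum := ⟨(2, 2), by decide⟩
  falsum := ⟨(0, 0), by decide⟩
  neg x := ⟨(x.1.2.rev, x.1.1.rev), by revert x; decide⟩
  and x y := ⟨x.1 ⊓ y.1, by revert x y; decide⟩
  or x y := ⟨x.1 ⊔ y.1, by revert x y; decide⟩
  designated := {x | x.1 = (2, 2)}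

end LogicalMatrix

section Logics

variable (V : Type*)

/-- Belnap–Dunn logic: the diamond with a prime filter (generated by one of the fixpoints of
negation) designated. -/
def BD : Logic V := (LogicalMatrix.DM4 {(true, true), (true, false)}).log V

/-- Exactly True Logic: the diamond with only the top designated. -/
def ETL : Logic V := (LogicalMatrix.DM4 {(true, true)}).log V

/-- Classical logic. -/
def CL : Logic V := LogicalMatrix.B2.log V

/-- Kleene's strong three-valued logic. -/
def K : Logic V := (LogicalMatrix.chain3 {2}).log V

/-- The Logic of Paradox. -/
def LP : Logic V := (LogicalMatrix.chain3 {1, 2}).log V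

/-- Kleene's logic of order. -/
def KO : Logic V := LP V ⊓ K V

/-- The logic `K⁻`. -/
def Kminus : Logic V := LogicalMatrix.M8.log V

/-- The logic `KO⁻`. -/
def KOminus : Logic V := LP V ⊓ Kminus V

/-- The rule `p, ¬p ⊢ q` (ex contradictione quodlibet), given by all its substitution instances. -/
def ecqRule : Set (Set (Formula V) × Formula V) :=
  {r | ∃ φ ψ : Formula V, r = ({φ, φ.neg}, ψ)}

/-- The rule `(p ∧ ¬p) ∨ (q ∧ ¬q) ⊢ r`, given by all its substitution instances. -/
def ecqRule₂ : Set (Set (Formula V) × Formula V) :=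
  {r | ∃ φ ψ χ : Formula V, r = ({(φ.and φ.neg).or (ψ.and ψ.neg)}, χ)}

/-- `ECQ` is the extension of `BD` by `p, ¬p ⊢ q`. -/
def ECQ : Logic V := (BD V).extend (ecqRule V)

/-- `ETL₂` is the extension of `ETL` by `(p ∧ ¬p) ∨ (q ∧ ¬q) ⊢ r`. -/
def ETL₂ : Logic V := (ETL V).extend (ecqRule₂ V)

end Logics

end SuperBelnap

open SuperBelnap

/-! Write `b` for `(true, false)` and `n` for `(false, true)`, the fixpoints of negation in the
diamond; `BD` designates `b`.

All upper bounds come from one device. If `L` extends the logic of `N` and a rule fails in `L`, the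
valuations in `N` designating the `L`-theory of the premises form a set `W` whose jointly designated
formulas are closed under `L` (`exists_models`). By `le_log`, `L` lies below the logic of `M` once
formulas can be chosen as names for the elements of `M` so that every `w ∈ W` gives names of
designated elements designated values, while some `w ∈ W` keeps a given undesignated element
undesignated. The failing rule supplies the names: for instance, if `φ, ¬φ` does not explode, then
`φ` has the value `b` throughout `W` and names the middle of the chain.

This yields dichotomies for extensions of `BD`: each contains the first logic of a pair or lies
below the second, the pairs being (`LP`, `K`), (`KO`, `Kminus`), (`ECQ`, `LP`), (`ETL`, `LPCL`),
(`LP ⊓ ECQ`, `BD`), and, above `ETL`, (`ETL₂`, `ETL`).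

Two lower bounds make the cuts meet. Above `ETL`, detachment recovers a logic from its intersection
with `LP` (`log_le_of_ETL_le`); and `LPCL ⊓ N ≤ (LP ⊓ N) ⊔ ECQ` for explosive `N` (`LPCL_inf_le`).
Strictness and disjointness follow from small countermodels. -/

namespace SuperBelnap

/-! ### Logics and sets of valuations closed under them -/

namespace Logic

variable {V : Type*}

theorem entails_of_mem (L : Logic V) {Γ : Set (Formula V)} {φ : Formula V} (h : φ ∈ Γ) :
    L.Entails Γ φ := by
  have := L.mono {φ} Γ φ (L.refl φ)
  rwa [Set.union_eq_self_of_subset_left (by simpa using h)] at this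

theorem le_extend (B : Logic V) (ρ : Set (Set (Formula V) × Formula V)) : B ≤ B.extend ρ :=
  fun _ _ h _ hL => hL.1 _ _ h

theorem extend_rule (B : Logic V) {ρ : Set (Set (Formula V) × Formula V)}
    {r : Set (Formula V) × Formula V} (hr : r ∈ ρ) : (B.extend ρ).Entails r.1 r.2 :=
  fun _ hL => hL.2 r hr

theorem extend_le {B L : Logic V} {ρ : Set (Set (Formula V) × Formula V)} (h : B ≤ L)
    (hρ : ∀ r ∈ ρ, L.Entails r.1 r.2) : B.extend ρ ≤ L :=
  fun _ _ k => k L ⟨h, hρ⟩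

theorem not_le {L L' : Logic V} (h : ¬ L ≤ L') :
    ∃ Γ φ, L.Entails Γ φ ∧ ¬ L'.Entails Γ φ := by
  by_contra! k
  exact h k

/-- The set of formulas which all valuations in `W` designate is a theory of each substitution
instance of `L`. -/
def Models (L : Logic V) (N : LogicalMatrix) (W : Set (V → N.Carrier)) : Prop :=
  ∀ Γ φ, L.Entails Γ φ → (∀ γ ∈ Γ, ∀ w ∈ W, N.eval w γ ∈ N.designated) →
    ∀ w ∈ W, N.eval w φ ∈ N.designated

/-- Since `N.log V ≤ L`, a formula designated by every valuation that designates the `L`-theory of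
`Γ` is already in that theory. So these valuations determine the theory exactly, and it is closed
under `L`. -/
theorem exists_models {L : Logic V} {N : LogicalMatrix} (hN : N.log V ≤ L)
    {Γ : Set (Formula V)} {φ : Formula V} (h : ¬ L.Entails Γ φ) :
    ∃ W, L.Models N W ∧ (∀ γ ∈ Γ, ∀ w ∈ W, N.eval w γ ∈ N.designated) ∧
      ∃ w ∈ W, N.eval w φ ∉ N.designated := by
  have key : ∀ ψ, (∀ w : V → N.Carrier, (∀ χ, L.Entails Γ χ → N.eval w χ ∈ N.designated) →
      N.eval w ψ ∈ N.designated) → L.Entails Γ ψ := fun ψ hψ =>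
    L.cut Γ {χ | L.Entails Γ χ} ψ (fun _ hδ => hδ) (hN _ _ hψ)
  refine ⟨{w | ∀ χ, L.Entails Γ χ → N.eval w χ ∈ N.designated}, ?_, ?_, ?_⟩
  · intro Δ ψ hΔ hd w hw
    exact hw _ (L.cut Γ Δ ψ (fun δ hδ => key δ fun w hw => hd δ hδ w hw) hΔ)
  · intro γ hγ w hw
    exact hw _ (L.entails_of_mem hγ)
  · by_contra! k
    exact h (key φ k)

end Logic

/-! ### Simulations, homomorphisms and comparison of matrices -/

namespace LogicalMatrix

variable {V : Type*}

/-- A relation between two matrices which is compatible with the operations. -/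
structure Simulation (M N : LogicalMatrix) (R : M.Carrier → N.Carrier → Prop) : Prop where
  verum : R M.verum N.verum
  falsum : R M.falsum N.falsum
  neg : ∀ x z, R x z → R (M.neg x) (N.neg z)
  and : ∀ x y z u, R x z → R y u → R (M.and x y) (N.and z u)
  or : ∀ x y z u, R x z → R y u → R (M.or x y) (N.or z u)

theorem Simulation.eval {M N : LogicalMatrix} {R : M.Carrier → N.Carrier → Prop}
    (h : Simulation M N R) {v : V → M.Carrier} {w : V → N.Carrier} (hR : ∀ p, R (v p) (w p))
    (φ : Formula V) : R (M.eval v φ) (N.eval w φ) := by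
  induction φ with
  | atom p => exact hR p
  | verum => exact h.verum
  | falsum => exact h.falsum
  | neg φ ih => exact h.neg _ _ ih
  | and φ ψ ih ih' => exact h.and _ _ _ _ ih ih'
  | or φ ψ ih ih' => exact h.or _ _ _ _ ih ih'

/-- A homomorphism between the algebras of two matrices. -/
structure IsHom (M N : LogicalMatrix) (h : M.Carrier → N.Carrier) : Prop where
  verum : h M.verum = N.verum
  falsum : h M.falsum = N.falsum
  neg : ∀ x, h (M.neg x) = N.neg (h x)
  and : ∀ x y, h (M.and x y) = N.and (h x) (h y)
  or : ∀ x y, h (M.or x y) = N.or (h x) (h y)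

theorem IsHom.simulation {M N : LogicalMatrix} {h : M.Carrier → N.Carrier} (hh : IsHom M N h) :
    Simulation M N (fun x z => h x = z) where
  verum := hh.verum
  falsum := hh.falsum
  neg := by rintro x _ rfl; exact hh.neg x
  and := by rintro x y _ _ rfl rfl; exact hh.and x y
  or := by rintro x y _ _ rfl rfl; exact hh.or x y

theorem IsHom.eval {M N : LogicalMatrix} {h : M.Carrier → N.Carrier} (hh : IsHom M N h)
    (v : V → M.Carrier) (φ : Formula V) : N.eval (fun p => h (v p)) φ = h (M.eval v φ) :=
  (hh.simulation.eval (w := fun p => h (v p)) (fun _ => rfl) φ).symm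

/-- A countervaluation in `M` composed with `h` is one in `N`. The homomorphism may depend on the
value `m` of the conclusion, so it suffices that `M` embeds subdirectly. -/
theorem log_le_log {M N : LogicalMatrix}
    (H : ∀ m ∉ M.designated, ∃ h : M.Carrier → N.Carrier, IsHom M N h ∧
      (∀ x ∈ M.designated, h x ∈ N.designated) ∧ h m ∉ N.designated) : N.log V ≤ M.log V := by
  intro Γ φ hΓ v hv
  by_contra hm
  obtain ⟨h, hh, hd, hn⟩ := H _ hm
  refine hn ?_
  rw [← hh.eval]
  refine hΓ _ fun γ hγ => ?_
  rw [hh.eval]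
  exact hd _ (hv γ hγ)

/-- A matrix is a model of `L` if each of its undesignated values is separated from the designated
ones by an assignment of formulas to its values, evaluated in a model of `L`. -/
theorem le_log {L : Logic V} {M : LogicalMatrix}
    (H : ∀ m ∉ M.designated, ∃ (N : LogicalMatrix) (W : Set (V → N.Carrier))
      (σ : M.Carrier → Formula V), L.Models N W ∧
      (∀ w ∈ W, ∃ R, Simulation M N R ∧ (∀ x, R x (N.eval w (σ x))) ∧
        ∀ x ∈ M.designated, ∀ z, R x z → z ∈ N.designated) ∧
      ∃ w ∈ W, ∃ R, Simulation M N R ∧ (∀ x, R x (N.eval w (σ x))) ∧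
        ∀ z, R m z → z ∉ N.designated) : L ≤ M.log V := by
  intro Γ φ hΓ v hv
  by_contra hm
  obtain ⟨N, W, σ, hW, hd, w, hw, R, hR, hσ, hn⟩ := H _ hm
  -- The countervaluation `v` becomes a substitution: each atom is replaced by the name of its
  -- value.
  have key := hW _ _ (L.struct Γ φ (fun p => σ (v p)) hΓ) ?_ w hw
  · rw [eval_subst] at key
    exact hn _ (hR.eval (fun p => hσ (v p)) φ) key
  · rintro _ ⟨γ, hγ, rfl⟩ w hw
    obtain ⟨R, hR, hσ, hd⟩ := hd w hw
    rw [eval_subst]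
    exact hd _ (hv γ hγ) _ (hR.eval (fun p => hσ (v p)) γ)

/-- The consequence relation of a finite matrix is compact. -/
theorem log_compact (M : LogicalMatrix) [Finite M.Carrier] {Γ : Set (Formula V)} {φ : Formula V}
    (h : (M.log V).Entails Γ φ) : ∃ l : List (Formula V), (∀ γ ∈ l, γ ∈ Γ) ∧
      (M.log V).Entails {γ | γ ∈ l} φ := by
  let _ : TopologicalSpace M.Carrier := ⊥
  have _ : DiscreteTopology M.Carrier := ⟨rfl⟩
  have cont : ∀ ψ : Formula V, Continuous fun v : V → M.Carrier => M.eval v ψ := by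
    intro ψ
    induction ψ with
    | atom p => exact continuous_apply p
    | verum => exact continuous_const
    | falsum => exact continuous_const
    | neg φ ih => exact continuous_of_discreteTopology.comp ih
    | and φ ψ ih ih' =>
      exact (continuous_of_discreteTopology (f := fun x : M.Carrier × M.Carrier =>
        M.and x.1 x.2)).comp (ih.prodMk ih')
    | or φ ψ ih ih' =>
      exact (continuous_of_discreteTopology (f := fun x : M.Carrier × M.Carrier =>
        M.or x.1 x.2)).comp (ih.prodMk ih')
  have hs : IsCompact {v : V → M.Carrier | M.eval v φ ∉ M.designated} :=
    ((isClosed_discrete (M.designated)ᶜ).preimage (cont φ)).isCompact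
  -- The space of valuations is a product of finite discrete spaces, hence compact; the rule says
  -- that certain closed sets have empty intersection.
  obtain ⟨u, hu⟩ := hs.elim_finite_subfamily_closed
    (fun γ : Γ => {v : V → M.Carrier | M.eval v γ ∈ M.designated})
    (fun γ => (isClosed_discrete M.designated).preimage (cont γ)) (by
      rw [Set.eq_empty_iff_forall_notMem]
      rintro v ⟨hv, hv'⟩
      exact hv (h v fun γ hγ => Set.mem_iInter.1 hv' ⟨γ, hγ⟩))
  refine ⟨u.toList.map Subtype.val, fun γ hγ => ?_, fun v hv => ?_⟩
  · obtain ⟨x, -, rfl⟩ := List.mem_map.1 hγ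
    exact x.2
  by_contra hn
  refine (Set.eq_empty_iff_forall_notMem.1 hu) v ⟨hn, ?_⟩
  simp only [Set.mem_iInter]
  exact fun γ hγ => hv γ (List.mem_map.2 ⟨γ, by simpa using hγ, rfl⟩)

/-- The product of the three-element chain with `{1, 2}` designated and the two-element Boolean
algebra. -/
def chainProd : LogicalMatrix where
  Carrier := Fin 3 × Bool
  verum := (2, true)
  falsum := (0, false)
  neg x := (x.1.rev, !x.2)
  and x y := x ⊓ y
  or x y := x ⊔ y
  designated := {x | x.1 ≠ 0 ∧ x.2 = true}

instance (F : Set (Bool × Bool)) : Fintype (DM4 F).Carrier := inferInstanceAs (Fintype (Bool × Bool))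
instance (F : Set (Bool × Bool)) : DecidableEq (DM4 F).Carrier :=
  inferInstanceAs (DecidableEq (Bool × Bool))
instance (F : Set (Fin 3)) : Fintype (chain3 F).Carrier := inferInstanceAs (Fintype (Fin 3))
instance (F : Set (Fin 3)) : DecidableEq (chain3 F).Carrier := inferInstanceAs (DecidableEq (Fin 3))
instance : Fintype B2.Carrier := inferInstanceAs (Fintype Bool)
instance : DecidableEq B2.Carrier := inferInstanceAs (DecidableEq Bool)
instance : Fintype M8.Carrier := inferInstanceAs (Fintype {x : Fin 3 × Fin 3 // x ≠ (0, 2)})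
instance : DecidableEq M8.Carrier :=
  inferInstanceAs (DecidableEq {x : Fin 3 × Fin 3 // x ≠ (0, 2)})
instance : Fintype chainProd.Carrier := inferInstanceAs (Fintype (Fin 3 × Bool))
instance : DecidableEq chainProd.Carrier := inferInstanceAs (DecidableEq (Fin 3 × Bool))

/-- The matrix which defines `BD`. -/
abbrev belnap : LogicalMatrix := DM4 {(true, true), (true, false)}

theorem mem_belnap (z : belnap.Carrier) : z ∈ belnap.designated ↔ z.1 = true := by
  obtain ⟨x, y⟩ := z
  change (x, y) ∈ ({(true, true), (true, false)} : Set (Bool × Bool)) ↔ x = true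
  cases x <;> cases y <;> simp

section Components

variable (F : Set (Bool × Bool)) (x y : (DM4 F).Carrier)

theorem neg_fst : ((DM4 F).neg x).1 = !x.2 := rfl
theorem neg_snd : ((DM4 F).neg x).2 = !x.1 := rfl
theorem and_fst : ((DM4 F).and x y).1 = (x.1 && y.1) := rfl
theorem and_snd : ((DM4 F).and x y).2 = (x.2 && y.2) := rfl
theorem or_fst : ((DM4 F).or x y).1 = (x.1 || y.1) := rfl
theorem or_snd : ((DM4 F).or x y).2 = (x.2 || y.2) := rfl

end Components

/-- Lower and upper bounds imposed on the values in the diamond by the predicates `P` and `Q`. -/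
theorem simulation_bounds {M : LogicalMatrix} (F : Set (Bool × Bool)) (P Q : M.Carrier → Prop)
    (hv : ¬ Q M.verum) (hf : ¬ P M.falsum) (hPn : ∀ x, P (M.neg x) → Q x)
    (hQn : ∀ x, Q (M.neg x) → P x)
    (hPa : ∀ x y, P (M.and x y) → P x ∧ P y) (hQa : ∀ x y, Q (M.and x y) → Q x ∨ Q y)
    (hPo : ∀ x y, P (M.or x y) → P x ∨ P y) (hQo : ∀ x y, Q (M.or x y) → Q x ∧ Q y) :
    Simulation M (DM4 F) (fun x z => (P x → z.1 = true) ∧ (Q x → z.2 = false)) where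
  verum := ⟨fun _ => rfl, fun h => absurd h hv⟩
  falsum := ⟨fun h => absurd h hf, fun _ => rfl⟩
  neg x z h := ⟨fun k => by simp [neg_fst, h.2 (hPn x k)],
    fun k => by simp [neg_snd, h.1 (hQn x k)]⟩
  and x y z u h k :=
    ⟨fun l => by simp [and_fst, h.1 (hPa x y l).1, k.1 (hPa x y l).2], fun l => by
      rcases hQa x y l with l | l
      · simp [and_snd, h.2 l]
      · simp [and_snd, k.2 l]⟩
  or x y z u h k :=
    ⟨fun l => by
      rcases hPo x y l with l | l
      · simp [or_fst, h.1 l]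
      · simp [or_fst, k.1 l],
      fun l => by simp [or_snd, h.2 (hQo x y l).1, k.2 (hQo x y l).2]⟩

theorem mem_DM4_top (z : (DM4 {(true, true)}).Carrier) :
    z ∈ (DM4 {(true, true)}).designated ↔ z = (DM4 {(true, true)}).verum := Iff.rfl
theorem mem_chain3_one (z : (chain3 {1, 2}).Carrier) :
    z ∈ (chain3 {1, 2}).designated ↔ z ≠ (chain3 {1, 2}).falsum := by
  change z = (1 : Fin 3) ∨ z = (2 : Fin 3) ↔ z ≠ (0 : Fin 3)
  revert z
  exact (by decide : ∀ z : Fin 3, z = 1 ∨ z = 2 ↔ z ≠ 0)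
theorem mem_chain3_two (z : (chain3 {2}).Carrier) :
    z ∈ (chain3 {2}).designated ↔ z = (chain3 {2}).verum := Iff.rfl
theorem mem_B2 (z : B2.Carrier) : z ∈ B2.designated ↔ z = B2.verum := Iff.rfl
theorem mem_M8 (z : M8.Carrier) : z ∈ M8.designated ↔ z = M8.verum := (Subtype.ext_iff (a1 := z) (a2 := M8.verum)).symm
theorem mem_chainProd (z : chainProd.Carrier) :
    z ∈ chainProd.designated ↔ z.1 ≠ 0 ∧ z.2 = true := Iff.rfl

/-! ### Homomorphisms between the concrete matrices -/

/-- The middle element of the chain. -/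
def chainMid (F : Set (Fin 3)) : (chain3 F).Carrier := (1 : Fin 3)

/-- The embeddings of the chain into the diamond, indexed by the image of the middle element. -/
def chainToDM4 (F : Set (Fin 3)) (F' : Set (Bool × Bool)) (c : Bool) :
    (chain3 F).Carrier → (DM4 F').Carrier := fun (x : Fin 3) =>
  if x = 0 then (false, false) else if x = 1 then (c, !c) else (true, true)

theorem chainToDM4_isHom (F : Set (Fin 3)) (F' : Set (Bool × Bool)) (c : Bool) :
    IsHom (chain3 F) (DM4 F') (chainToDM4 F F' c) := by
  -- Being a homomorphism does not depend on the designated sets, so they are fixed to make the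
  -- statement decidable.
  have h : IsHom (chain3 ∅) (DM4 ∅) (chainToDM4 ∅ ∅ c) := by
    constructor <;> revert c <;> decide
  exact ⟨h.1, h.2, h.3, h.4, h.5⟩

theorem DM4_id_isHom (F F' : Set (Bool × Bool)) : IsHom (DM4 F) (DM4 F') fun x => x :=
  ⟨rfl, rfl, fun _ => rfl, fun _ _ => rfl, fun _ _ => rfl⟩

/-- The automorphism of the diamond which exchanges the fixpoints of negation. -/
def DM4Swap (F F' : Set (Bool × Bool)) : (DM4 F).Carrier → (DM4 F').Carrier := fun x => (x.2, x.1)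

theorem DM4_swap_isHom (F F' : Set (Bool × Bool)) : IsHom (DM4 F) (DM4 F') (DM4Swap F F') :=
  ⟨rfl, rfl, fun _ => rfl, fun _ _ => rfl, fun _ _ => rfl⟩

/-- The embedding of the two-element Boolean algebra into the chain. -/
def B2ToChain (F : Set (Fin 3)) : B2.Carrier → (chain3 F).Carrier := fun (x : Bool) =>
  if x then (2 : Fin 3) else (0 : Fin 3)

theorem B2ToChain_isHom (F : Set (Fin 3)) : IsHom B2 (chain3 F) (B2ToChain F) := by
  have h : IsHom B2 (chain3 ∅) (B2ToChain ∅) := by constructor <;> decide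
  exact ⟨h.1, h.2, h.3, h.4, h.5⟩

/-- The embedding of the two-element Boolean algebra into the diamond. -/
def B2ToDM4 (F : Set (Bool × Bool)) : B2.Carrier → (DM4 F).Carrier := fun (x : Bool) => (x, x)

theorem B2ToDM4_isHom (F : Set (Bool × Bool)) : IsHom B2 (DM4 F) (B2ToDM4 F) := by
  have h : IsHom B2 (DM4 ∅) (B2ToDM4 ∅) := by constructor <;> decide
  exact ⟨h.1, h.2, h.3, h.4, h.5⟩

/-- The homomorphism of `M8` onto the diamond. -/
def M8ToDM4 (F : Set (Bool × Bool)) : M8.Carrier → (DM4 F).Carrier := fun x =>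
  (decide (x.1.1 = 2), decide (x.1.2 ≠ 0))

theorem M8ToDM4_isHom (F : Set (Bool × Bool)) : IsHom M8 (DM4 F) (M8ToDM4 F) := by
  have h : IsHom M8 (DM4 ∅) (M8ToDM4 ∅) := by constructor <;> decide
  exact ⟨h.1, h.2, h.3, h.4, h.5⟩

/-- The homomorphism of `M8` onto the chain. -/
def M8ToChain (F : Set (Fin 3)) : M8.Carrier → (chain3 F).Carrier := fun x =>
  if x.1.2 = 2 then (2 : Fin 3) else if x.1.1 = 0 then (0 : Fin 3) else (1 : Fin 3)

theorem M8ToChain_isHom (F : Set (Fin 3)) : IsHom M8 (chain3 F) (M8ToChain F) := by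
  have h : IsHom M8 (chain3 ∅) (M8ToChain ∅) := by constructor <;> decide
  exact ⟨h.1, h.2, h.3, h.4, h.5⟩

/-- The diagonal embedding of the chain into `M8`. -/
def chainToM8 (F : Set (Fin 3)) : (chain3 F).Carrier → M8.Carrier := fun x =>
  ⟨(x, x), by revert x; exact (by decide : ∀ x : Fin 3, (x, x) ≠ (0, 2))⟩

theorem chainToM8_isHom (F : Set (Fin 3)) : IsHom (chain3 F) M8 (chainToM8 F) := by
  have h : IsHom (chain3 ∅) M8 (chainToM8 ∅) := by constructor <;> decide
  exact ⟨h.1, h.2, h.3, h.4, h.5⟩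

theorem chain3_id_isHom (F F' : Set (Fin 3)) : IsHom (chain3 F) (chain3 F') fun x => x :=
  ⟨rfl, rfl, fun _ => rfl, fun _ _ => rfl, fun _ _ => rfl⟩

theorem chainProd_fst_isHom (F : Set (Fin 3)) :
    IsHom chainProd (chain3 F) (fun x : Fin 3 × Bool => x.1) :=
  ⟨rfl, rfl, fun _ => rfl, fun _ _ => rfl, fun _ _ => rfl⟩

theorem chainProd_snd_isHom : IsHom chainProd B2 (fun x : Fin 3 × Bool => x.2) :=
  ⟨rfl, rfl, fun _ => rfl, fun _ _ => rfl, fun _ _ => rfl⟩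

/-- The values in the chain refined by a classical truth value. -/
theorem B2_chain_simulation (F : Set (Fin 3)) : Simulation B2 (chain3 F)
    (fun x z => if x = B2.verum then z ≠ (chain3 F).falsum else z ≠ (chain3 F).verum) := by
  have h : Simulation B2 (chain3 ∅)
      (fun x z => if x = B2.verum then z ≠ (chain3 ∅).falsum else z ≠ (chain3 ∅).verum) := by constructor <;> decide
  exact ⟨h.1, h.2, h.3, h.4, h.5⟩

end LogicalMatrix

open LogicalMatrix

/-! ### Inclusions between the named logics, and countermodels -/

section Comparisons

variable (V : Type*)

theorem BD_le_ETL : BD V ≤ ETL V := log_le_log fun m hm => by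
  simp only [mem_DM4_top, mem_belnap] at hm ⊢
  -- The identity separates every value except `b`, which the swap sends to the undesignated `n`.
  by_cases h : m.1 = true
  · exact ⟨_, DM4_swap_isHom _ _, by decide, by revert m; decide⟩
  · exact ⟨_, DM4_id_isHom _ _, by decide, h⟩

theorem BD_le_LP : BD V ≤ LP V := log_le_log fun m hm => by
  simp only [mem_chain3_one, mem_belnap] at hm ⊢
  exact ⟨_, chainToDM4_isHom _ _ true, by decide, by revert m; decide⟩

theorem ETL_le_Kminus : ETL V ≤ Kminus V := log_le_log fun m hm => by
  simp only [mem_M8, mem_DM4_top] at hm ⊢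
  -- Here `m` is `(1, 2)`, which the diamond separates from the top; the remaining values are
  -- separated in the chain.
  by_cases h : m.1.2 = 2
  · exact ⟨_, M8ToDM4_isHom _, by decide, by revert m; decide⟩
  · refine ⟨fun x => chainToDM4 {2} _ true (M8ToChain {2} x), ?_, by decide, by revert m; decide⟩
    constructor <;> decide

theorem Kminus_le_K : Kminus V ≤ K V := log_le_log fun m hm => by
  simp only [mem_chain3_two, mem_M8] at hm ⊢
  exact ⟨_, chainToM8_isHom _, by decide, by revert m; decide⟩

theorem K_le_CL : K V ≤ CL V := log_le_log fun m hm => by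
  simp only [mem_chain3_two, mem_B2] at hm ⊢
  exact ⟨_, B2ToChain_isHom _, by decide, by revert m; decide⟩

theorem LP_le_CL : LP V ≤ CL V := log_le_log fun m hm => by
  simp only [mem_chain3_one, mem_B2] at hm ⊢
  exact ⟨_, B2ToChain_isHom _, by decide, by revert m; decide⟩

theorem BD_le_Kminus : BD V ≤ Kminus V := (BD_le_ETL V).trans (ETL_le_Kminus V)
theorem BD_le_K : BD V ≤ K V := (BD_le_Kminus V).trans (Kminus_le_K V)
theorem BD_le_CL : BD V ≤ CL V := (BD_le_K V).trans (K_le_CL V)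
theorem BD_le_KOminus : BD V ≤ KOminus V := le_inf (BD_le_LP V) (BD_le_Kminus V)
theorem BD_le_ECQ : BD V ≤ ECQ V := Logic.le_extend _ _

theorem ECQ_le_ETL : ECQ V ≤ ETL V := by
  refine Logic.extend_le (BD_le_ETL V) ?_
  rintro _ ⟨φ, ψ, rfl⟩ v hv
  have h₁ := hv φ (by simp)
  have h₂ := hv φ.neg (by simp)
  simp only [mem_DM4_top, eval] at h₁ h₂
  rw [h₁] at h₂
  exact absurd h₂ (by decide)

/-- A contradiction is at most the middle element in the chain image of `M8`, so a join of two
contradictions is never the top. -/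
theorem ETL₂_le_Kminus : ETL₂ V ≤ Kminus V := by
  refine Logic.extend_le (ETL_le_Kminus V) ?_
  rintro _ ⟨φ, ψ, χ, rfl⟩ v hv
  have h := hv _ rfl
  simp only [mem_M8, eval] at h
  revert h
  generalize M8.eval v φ = a
  generalize M8.eval v ψ = b
  intro h
  exfalso
  revert a b
  decide

theorem ECQ_le_Kminus : ECQ V ≤ Kminus V := (ECQ_le_ETL V).trans (ETL_le_Kminus V)

/-- The logic of the product of the matrices of `LP` and `CL`. -/
def LPCL : Logic V := chainProd.log V

theorem LP_le_LPCL : LP V ≤ LPCL V := fun Γ φ h v hv => by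
  have h₁ : ∀ ψ, (chain3 {1, 2}).eval (fun p => (v p).1) ψ = (chainProd.eval v ψ).1 :=
    (chainProd_fst_isHom _).eval v
  have h₂ : ∀ ψ, B2.eval (fun p => (v p).2) ψ = (chainProd.eval v ψ).2 :=
    chainProd_snd_isHom.eval v
  refine ⟨?_, ?_⟩
  · rw [← h₁]
    exact (mem_chain3_one _).1 (h _ fun γ hγ => (mem_chain3_one _).2 <| h₁ γ ▸ (hv γ hγ).1)
  · rw [← h₂]
    exact LP_le_CL V Γ φ h _ fun γ hγ => (mem_B2 _).2 <| h₂ γ ▸ (hv γ hγ).2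

theorem ECQ_le_LPCL : ECQ V ≤ LPCL V := by
  refine Logic.extend_le ((BD_le_LP V).trans (LP_le_LPCL V)) ?_
  rintro _ ⟨φ, ψ, rfl⟩ v hv
  have h₁ := hv φ (by simp)
  have h₂ := hv φ.neg (by simp)
  simp only [mem_chainProd, eval] at h₁ h₂
  have h₃ : (!(chainProd.eval v φ).2) = true := h₂.2
  simp [h₁.2] at h₃

theorem CL_ne_top : CL V ≠ ⊤ := by
  intro h
  have : (CL V).Entails ∅ .falsum := by rw [h]; trivial
  have := this (fun _ => true) (by simp)
  simp only [eval, mem_B2] at this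
  exact absurd this (by decide)

theorem exists_two_atoms [Infinite V] : ∃ v : V → Bool, ∃ p q, v p = true ∧ v q = false := by
  classical
  obtain ⟨p, q, h⟩ := exists_pair_ne V
  exact ⟨fun r => decide (r = p), p, q, by simp, by simp [h.symm]⟩

variable [Infinite V]

theorem not_ETL₂_le_ETL : ¬ ETL₂ V ≤ ETL V := by
  intro h
  obtain ⟨v, p, q, hp, hq⟩ := exists_two_atoms V
  -- The atoms `p` and `q` get the two fixpoints of negation, whose join is the top.
  have := h _ _ (Logic.extend_rule _ ⟨.atom p, .atom q, .falsum, rfl⟩) (fun r => (v r, !v r)) (by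
    simp only [Set.mem_singleton_iff, forall_eq, eval, hp, hq, mem_DM4_top]
    decide)
  simp only [mem_DM4_top, eval] at this
  exact absurd this (by decide)

theorem not_KO_le_Kminus : ¬ KO V ≤ Kminus V := by
  intro h
  obtain ⟨v, p, q, hp, hq⟩ := exists_two_atoms V
  -- With `p` at the fixpoint `(2, 0)` and `q` at `(1, 2)`, the premise is `(2, 2)`, whereas `q ∨
  -- ¬q` stays at `(1, 2)`.
  have := h {((Formula.atom p).and (Formula.atom p).neg).or (.atom q)}
    ((Formula.atom q).or (Formula.atom q).neg) ?_
    (fun r => if v r then ⟨(2, 0), by decide⟩ else ⟨(1, 2), by decide⟩) ?_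
  · simp only [eval, hq, mem_M8] at this
    exact absurd this (by decide)
  · constructor
    · intro v hv
      have := hv _ rfl
      simp only [eval, mem_chain3_one] at this ⊢
      generalize v p = a at *
      generalize v q = b at *
      revert a b
      decide
    · intro v hv
      have := hv _ rfl
      simp only [eval, mem_chain3_two] at this ⊢
      generalize v p = a at *
      generalize v q = b at *
      revert a b
      decide
  · simp only [Set.mem_singleton_iff, forall_eq, eval, hp, hq, mem_M8]
    decide

theorem not_LP_le_K : ¬ LP V ≤ K V := by
  intro h
  obtain ⟨v, p, q, hp, hq⟩ := exists_two_atoms V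
  have := h ∅ ((Formula.atom p).or (Formula.atom p).neg) ?_ (fun _ => chainMid _) (by simp)
  · simp only [eval, mem_chain3_two] at this
    exact absurd this (by decide)
  · intro v _
    simp only [eval, mem_chain3_one]
    generalize v p = a
    revert a
    decide

theorem not_ECQ_le_LP : ¬ ECQ V ≤ LP V := by
  intro h
  obtain ⟨v, p, q, hp, hq⟩ := exists_two_atoms V
  have := h _ _ (Logic.extend_rule _ ⟨.atom p, .falsum, rfl⟩) (fun r => chainMid _) (by
    simp only [Set.mem_insert_iff, Set.mem_singleton_iff, forall_eq_or_imp, forall_eq, eval,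
      mem_chain3_one]
    decide)
  simp only [mem_chain3_one, eval] at this
  exact absurd this (by decide)

theorem not_ETL_le_LPCL : ¬ ETL V ≤ LPCL V := by
  intro h
  obtain ⟨v, p, q, hp, hq⟩ := exists_two_atoms V
  -- Modus ponens fails in the product: at `p = (1, true)` and `q = (0, true)` the value of `¬p ∨ q`
  -- is `(1, true)`.
  have := h {.atom p, (Formula.atom p).neg.or (.atom q)} (.atom q) ?_
    (fun r => if v r then (1, true) else (0, true)) ?_
  · simp only [eval, hq, mem_chainProd] at this
    exact absurd this (by decide)
  · intro v hv
    simp only [Set.mem_insert_iff, Set.mem_singleton_iff, forall_eq_or_imp, forall_eq, eval,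
      mem_DM4_top] at hv ⊢
    generalize v p = a at *
    generalize v q = b at *
    revert a b
    decide
  · simp only [Set.mem_insert_iff, Set.mem_singleton_iff, forall_eq_or_imp, forall_eq, eval,
      mem_chainProd, hp, hq]
    decide

end Comparisons

section Extensions

variable {V : Type*}

theorem eval_DM4 (F F' : Set (Bool × Bool)) (w : V → Bool × Bool) (φ : Formula V) :
    (DM4 F).eval w φ = (DM4 F').eval w φ :=
  ((DM4_id_isHom F F').eval w φ).symm

/-! ### Reduction to a single premise -/

section SinglePremise

/-- The conjunction of a list of formulas. -/
def Formula.conj (l : List (Formula V)) : Formula V := l.foldr .and .verum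

theorem conj_fst (w : V → belnap.Carrier) (l : List (Formula V)) :
    (belnap.eval w (Formula.conj l)).1 = true ↔ ∀ γ ∈ l, (belnap.eval w γ).1 = true := by
  induction l with
  | nil => exact ⟨fun _ => by simp, fun _ => rfl⟩
  | cons γ l ih =>
    change (belnap.and (belnap.eval w γ) (belnap.eval w (Formula.conj l))).1 = true ↔ _
    simp [and_fst, ih]

/-- By compactness finitely many premises suffice, and `BD` can replace them by their conjunction.
-/
theorem exists_premise {M : LogicalMatrix} [Finite M.Carrier] (hM : BD V ≤ M.log V)
    {Γ : Set (Formula V)} {φ : Formula V} (h : (M.log V).Entails Γ φ) :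
    ∃ γ, (BD V).Entails Γ γ ∧ (M.log V).Entails {γ} φ := by
  obtain ⟨l, hl, h⟩ := log_compact M h
  refine ⟨.conj l, fun w hw => (mem_belnap _).2 <| (conj_fst w l).2 fun γ hγ =>
    (mem_belnap _).1 <| hw γ (hl γ hγ), (M.log V).cut _ _ _ (fun δ hδ => hM _ _ ?_) h⟩
  exact fun w hw => (mem_belnap _).2 <| (conj_fst w l).1 ((mem_belnap _).1 <| hw _ rfl) δ hδ

theorem Logic.entails_of_premise {L : Logic V} (hL : BD V ≤ L) {Γ : Set (Formula V)}
    {γ φ : Formula V} (h : (BD V).Entails Γ γ) (h' : L.Entails {γ} φ) : L.Entails Γ φ :=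
  L.cut Γ {γ} φ (by rintro _ rfl; exact hL _ _ h) h'

end SinglePremise

/-! ### Naming the elements of a matrix by formulas -/

section Terms

/-- Here and below, the matrix is generated by its constants and at most two further elements. Once
formulas name these generators, every simulation respecting the names of the generators respects all
names. -/
theorem exists_term_B2 (x : B2.Carrier) : ∃ θ : Formula V, ∀ (N : LogicalMatrix)
    (w : V → N.Carrier) R, Simulation B2 N R → R x (N.eval w θ) := by
  obtain (_ | _) : Bool := x
  · exact ⟨.falsum, fun N w R h => h.falsum⟩
  · exact ⟨.verum, fun N w R h => h.verum⟩

theorem exists_term_chain3 (F : Set (Fin 3)) (a : Formula V) (x : (chain3 F).Carrier) :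
    ∃ θ : Formula V, ∀ (N : LogicalMatrix) (w : V → N.Carrier) R, Simulation (chain3 F) N R →
      R (chainMid F) (N.eval w a) → R x (N.eval w θ) := by
  change Fin 3 at x
  fin_cases x
  · exact ⟨.falsum, fun N w R h _ => h.falsum⟩
  · exact ⟨a, fun N w R _ h => h⟩
  · exact ⟨.verum, fun N w R h _ => h.verum⟩

theorem exists_term_DM4 (F : Set (Bool × Bool)) (a b : Formula V) (x : (DM4 F).Carrier) :
    ∃ θ : Formula V, ∀ (N : LogicalMatrix) (w : V → N.Carrier) R, Simulation (DM4 F) N R →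
      R (true, false) (N.eval w a) → R (false, true) (N.eval w b) → R x (N.eval w θ) := by
  obtain ⟨_ | _, _ | _⟩ := x
  · exact ⟨.falsum, fun N w R h _ _ => h.falsum⟩
  · exact ⟨b, fun N w R _ _ h => h⟩
  · exact ⟨a, fun N w R _ h _ => h⟩
  · exact ⟨.verum, fun N w R h _ _ => h.verum⟩

theorem exists_term_chainProd (a b : Formula V) (x : chainProd.Carrier) :
    ∃ θ : Formula V, ∀ (N : LogicalMatrix) (w : V → N.Carrier) R, Simulation chainProd N R →
      R ((1 : Fin 3), true) (N.eval w a) → R ((0 : Fin 3), true) (N.eval w b) →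
      R x (N.eval w θ) := by
  obtain ⟨x, _ | _⟩ := x
  · fin_cases x
    · exact ⟨.falsum, fun N w R h _ _ => h.falsum⟩
    · exact ⟨.neg a, fun N w R h ha _ => h.neg _ _ ha⟩
    · exact ⟨.neg b, fun N w R h _ hb => h.neg _ _ hb⟩
  · fin_cases x
    · exact ⟨b, fun N w R _ _ h => h⟩
    · exact ⟨a, fun N w R _ h _ => h⟩
    · exact ⟨.verum, fun N w R h _ _ => h.verum⟩

theorem exists_term_M8 (c b : Formula V) (x : M8.Carrier) :
    ∃ θ : Formula V, ∀ (N : LogicalMatrix) (w : V → N.Carrier) R, Simulation M8 N R →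
      R ⟨(2, 0), by decide⟩ (N.eval w c) → R ⟨(1, 2), by decide⟩ (N.eval w b) →
      R x (N.eval w θ) := by
  obtain ⟨⟨x, y⟩, hx⟩ := x
  fin_cases x <;> fin_cases y
  · exact ⟨.falsum, fun N w R h _ _ => h.falsum⟩
  · exact ⟨.neg b, fun N w R h _ hb => h.neg _ _ hb⟩
  · exact absurd rfl hx
  · exact ⟨.and b c, fun N w R h hc hb => h.and _ _ _ _ hb hc⟩
  · exact ⟨.and b (.or c b.neg), fun N w R h hc hb =>
      h.and _ _ _ _ hb (h.or _ _ _ _ hc (h.neg _ _ hb))⟩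
  · exact ⟨b, fun N w R _ _ h => h⟩
  · exact ⟨c, fun N w R _ h _ => h⟩
  · exact ⟨.or c b.neg, fun N w R h hc hb => h.or _ _ _ _ hc (h.neg _ _ hb)⟩
  · exact ⟨.verum, fun N w R h _ _ => h.verum⟩

end Terms

/-! ### Valuations in the diamond that live on a chain -/

section ChainValuations

/-- The list of atoms of a formula. -/
def Formula.atoms : Formula V → List V
  | .atom p => [p]
  | .verum => []
  | .falsum => []
  | .neg φ => φ.atoms
  | .and φ ψ => φ.atoms ++ ψ.atoms
  | .or φ ψ => φ.atoms ++ ψ.atoms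

theorem eval_congr (M : LogicalMatrix) {v w : V → M.Carrier} (φ : Formula V)
    (h : ∀ p ∈ φ.atoms, v p = w p) : M.eval v φ = M.eval w φ := by
  induction φ with
  | atom p => exact h p (by simp [Formula.atoms])
  | verum => rfl
  | falsum => rfl
  | neg φ ih => exact congrArg M.neg (ih h)
  | and φ ψ ih ih' =>
    exact congrArg₂ M.and (ih fun p hp => h p (List.mem_append_left _ hp))
      (ih' fun p hp => h p (List.mem_append_right _ hp))
  | or φ ψ ih ih' =>
    exact congrArg₂ M.or (ih fun p hp => h p (List.mem_append_left _ hp))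
      (ih' fun p hp => h p (List.mem_append_right _ hp))

/-- A valuation in the diamond which omits one of the fixpoints on a set of atoms agrees with a
valuation in the chain. -/
theorem exists_chain_valuation (F : Set (Fin 3)) (F' : Set (Bool × Bool)) (c : Bool)
    (w : V → (DM4 F').Carrier) (S : Set V) (hw : ∀ p ∈ S, (w p).1 = c ∨ (w p).2 = !c) :
    ∃ v : V → (chain3 F).Carrier, ∀ φ : Formula V, (∀ p ∈ φ.atoms, p ∈ S) →
      (DM4 F').eval w φ = chainToDM4 F F' c ((chain3 F).eval v φ) := by
  have key : ∀ p, ∃ x, p ∈ S → chainToDM4 F F' c x = w p := by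
    intro p
    by_cases hp : p ∈ S
    · have h := hw p hp
      generalize w p = z at h
      have : ∀ (c : Bool) (z : (DM4 ∅).Carrier), z.1 = c ∨ z.2 = !c →
        ∃ x, chainToDM4 ∅ ∅ c x = z := by decide
      obtain ⟨x, hx⟩ := this c z h
      exact ⟨x, fun _ => hx⟩
    · exact ⟨(chain3 F).falsum, fun h => absurd h hp⟩
  choose v hv using key
  refine ⟨v, fun φ hφ => ?_⟩
  rw [← (chainToDM4_isHom F F' c).eval]
  exact eval_congr _ φ fun p hp => (hv p (hφ p hp)).symm

/-- A valuation avoiding `n` lives on the chain through `b`, which with the designation of `BD` is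
the matrix of `LP`. -/
theorem exists_atom_of_LP {Γ : Set (Formula V)} {φ : Formula V} (h : (LP V).Entails Γ φ)
    {w : V → belnap.Carrier} (hw : ∀ γ ∈ Γ, belnap.eval w γ ∈ belnap.designated)
    (hφ : belnap.eval w φ ∉ belnap.designated) : ∃ p, w p = (false, true) := by
  by_contra! hn
  obtain ⟨v, hv⟩ := exists_chain_valuation {1, 2} {(true, true), (true, false)} true w Set.univ
    (fun p _ => by
      have := hn p
      generalize w p = z at *
      revert z
      exact (by decide : ∀ z : Bool × Bool, z ≠ (false, true) → z.1 = true ∨ z.2 = !true))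
  have hd : ∀ ψ, belnap.eval w ψ ∈ belnap.designated ↔
      (chain3 {1, 2}).eval v ψ ∈ (chain3 {1, 2}).designated := fun ψ => by
    rw [hv ψ fun _ _ => trivial, mem_belnap, mem_chain3_one]
    generalize (chain3 {1, 2}).eval v ψ = x
    revert x
    decide
  exact hφ ((hd φ).2 (h v fun γ hγ => (hd γ).1 (hw γ hγ)))

/-- Dually, avoiding `b` leaves the chain through `n`, the matrix of `K`. With a single premise the
atom comes from a finite list fixed in advance, so one finite disjunction covers all valuations. -/
theorem exists_atom_of_K {γ φ : Formula V} (h : (K V).Entails {γ} φ)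
    {w : V → belnap.Carrier} (hw : belnap.eval w γ ∈ belnap.designated)
    (hφ : belnap.eval w φ ∉ belnap.designated) :
    ∃ p ∈ γ.atoms ++ φ.atoms, w p = (true, false) := by
  by_contra! hn
  obtain ⟨v, hv⟩ := exists_chain_valuation {2} {(true, true), (true, false)} false w
    {p | p ∈ γ.atoms ++ φ.atoms}
    (fun p hp => by
      have := hn p hp
      generalize w p = z at *
      revert z
      exact (by decide : ∀ z : Bool × Bool, z ≠ (true, false) → z.1 = false ∨ z.2 = !false))
  have hd : ∀ ψ, (∀ p ∈ ψ.atoms, p ∈ γ.atoms ++ φ.atoms) → (belnap.eval w ψ ∈ belnap.designated ↔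
      (chain3 {2}).eval v ψ ∈ (chain3 {2}).designated) := fun ψ hψ => by
    rw [hv ψ hψ, mem_belnap, mem_chain3_two]
    generalize (chain3 {2}).eval v ψ = x
    revert x
    decide
  refine hφ ((hd φ (by simp +contextual)).2 (h v ?_))
  rintro _ rfl
  exact (hd _ (by simp +contextual)).1 hw

end ChainValuations

/-! ### Upper bounds obtained from a failing rule -/

section Models

variable {L : Logic V}

theorem le_CL (hL : BD V ≤ L) (h : L ≠ ⊤) : L ≤ CL V := by
  obtain ⟨Γ, φ, -, hφ⟩ := Logic.not_le (fun k : ⊤ ≤ L => h (top_le_iff.1 k))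
  obtain ⟨W, hW, -, w₀, hw₀, -⟩ := Logic.exists_models hL hφ
  choose σ hσ using exists_term_B2 (V := V)
  have hh := B2ToDM4_isHom {(true, true), (true, false)}
  refine le_log fun m hm => ⟨belnap, W, σ, hW,
    fun w hw => ⟨_, hh.simulation, fun x => hσ x _ w _ hh.simulation, ?_⟩,
    w₀, hw₀, _, hh.simulation, fun x => hσ x _ w₀ _ hh.simulation, ?_⟩
  · rintro x hx _ rfl
    exact (mem_belnap _).2 hx
  · rintro _ rfl h
    exact hm ((mem_belnap _).1 h)

/-- If `φ, ¬φ` does not explode, `φ` takes the value `b` throughout `W` and names the middle of the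
chain. -/
theorem le_LP (hL : BD V ≤ L) (h : ¬ ECQ V ≤ L) : L ≤ LP V := by
  have : ∃ φ ψ, ¬ L.Entails {φ, φ.neg} ψ := by
    by_contra! k
    refine h (Logic.extend_le hL ?_)
    rintro _ ⟨φ, ψ, rfl⟩
    exact k φ ψ
  obtain ⟨φ, ψ, hφ⟩ := this
  obtain ⟨W, hW, hd, w₀, hw₀, -⟩ := Logic.exists_models hL hφ
  choose σ hσ using exists_term_chain3 {1, 2} φ
  have hh := (chainToDM4_isHom {1, 2} {(true, true), (true, false)} true).simulation
  have key : ∀ w ∈ W, chainToDM4 {1, 2} _ true (chainMid _) = belnap.eval w φ := fun w hw => by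
    have h₁ := (mem_belnap _).1 (hd φ (by simp) w hw)
    have h₂ := (mem_belnap _).1 (hd φ.neg (by simp) w hw)
    simp only [eval] at h₂
    generalize belnap.eval w φ = a at *
    revert a
    decide
  refine le_log fun m hm => ⟨belnap, W, σ, hW,
    fun w hw => ⟨_, hh, fun x => hσ x _ w _ hh (key w hw), ?_⟩,
    w₀, hw₀, _, hh, fun x => hσ x _ w₀ _ hh (key w₀ hw₀), ?_⟩
  · rintro x hx _ rfl
    rw [mem_belnap]
    rw [mem_chain3_one] at hx
    revert x
    decide
  · rintro _ rfl
    rw [mem_belnap]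
    rw [mem_chain3_one] at hm
    revert m
    decide

theorem exists_models_of_not_LP_le (hL : BD V ≤ L) (h : ¬ LP V ≤ L) :
    ∃ W, L.Models belnap W ∧ ∃ w ∈ W, ∃ p, w p = (false, true) := by
  obtain ⟨Γ, φ, hΓ, hφ⟩ := Logic.not_le h
  obtain ⟨W, hW, hd, w₀, hw₀, hn⟩ := Logic.exists_models hL hφ
  exact ⟨W, hW, w₀, hw₀, exists_atom_of_LP hΓ (fun γ hγ => hd γ hγ _ hw₀) hn⟩

/-- An atom with value `n` at `w₀` names the middle. Elsewhere in `W` its value is arbitrary, but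
only the top must remain designated, so the simulation by bounds suffices. -/
theorem le_K (hL : BD V ≤ L) (h : ¬ LP V ≤ L) : L ≤ K V := by
  obtain ⟨W, hW, w₀, hw₀, p, hp⟩ := exists_models_of_not_LP_le hL h
  choose σ hσ using exists_term_chain3 {2} (.atom p)
  have hh := (chainToDM4_isHom {2} {(true, true), (true, false)} false).simulation
  have hb : Simulation (chain3 {2}) belnap _ := simulation_bounds _
    (fun x => x = (chain3 {2}).verum) (fun x => x = (chain3 {2}).falsum) (by decide) (by decide)
    (by decide) (by decide) (by decide) (by decide) (by decide) (by decide)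
  refine le_log fun m hm => ⟨belnap, W, σ, hW,
    fun w hw => ⟨_, hb, fun x => hσ x _ w _ hb ⟨fun k => ?_, fun k => ?_⟩, fun x hx z hz => ?_⟩,
    w₀, hw₀, _, hh, fun x => hσ x _ w₀ _ hh ?_, ?_⟩
  · exact absurd k (by decide)
  · exact absurd k (by decide)
  · exact (mem_belnap z).2 (hz.1 hx)
  · exact hp.symm
  · rintro _ rfl
    rw [mem_belnap]
    rw [mem_chain3_two] at hm
    revert m
    decide

/-- Let `γ ⊢ φ` be a rule of `ETL` failing in `L`. Where `φ` is undesignated, `γ` is designated but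
not the top, so `γ` is `b` and `γ ∧ φ` is the bottom: these two formulas name the generators. Where
`φ` is designated, both names are designated and bounds from the Boolean component suffice. -/
theorem le_LPCL (hL : BD V ≤ L) (h : ¬ ETL V ≤ L) : L ≤ LPCL V := by
  obtain ⟨Γ, φ, hΓ, hφ⟩ := Logic.not_le h
  obtain ⟨γ, hγ, hγφ⟩ := exists_premise (BD_le_ETL V) hΓ
  obtain ⟨W, hW, hd, w₀, hw₀, hn⟩ := Logic.exists_models hL
    (fun k => hφ (Logic.entails_of_premise hL hγ k))
  have hb : Simulation chainProd belnap _ := simulation_bounds _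
    (fun x : chainProd.Carrier => x.2 = true) (fun x : chainProd.Carrier => x.2 = false) (by decide) (by decide)
    (by decide) (by decide) (by decide) (by decide) (by decide) (by decide)
  have hbd : ∀ x ∈ chainProd.designated, ∀ z : belnap.Carrier,
      (x.2 = true → z.1 = true) ∧ (x.2 = false → z.2 = false) → z ∈ belnap.designated :=
    fun x hx z hz => (mem_belnap z).2 (hz.1 hx.2)
  refine le_log fun m hm => ?_
  by_cases hm₂ : m.2 = true
  · choose σ hσ using exists_term_chainProd γ (γ.and φ)
    have hh : IsHom chainProd belnap (fun x => chainToDM4 {1, 2} _ true x.1) := by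
      constructor <;> decide
    have key : ∀ w ∈ W, belnap.eval w φ ∉ belnap.designated →
        chainToDM4 {1, 2} _ true (1 : Fin 3) = belnap.eval w γ ∧
        chainToDM4 {1, 2} _ true (0 : Fin 3) = belnap.eval w (γ.and φ) := fun w hw hφ => by
      have h₁ := (mem_belnap _).1 (hd γ rfl w hw)
      have e := eval_DM4 {(true, true)} {(true, true), (true, false)} w
      have h₂ : belnap.eval w γ = belnap.verum → belnap.eval w φ = belnap.verum := fun k =>
        (e φ).symm.trans ((mem_DM4_top _).1 (hγφ w fun δ hδ => by
          rw [Set.mem_singleton_iff.1 hδ]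
          exact (mem_DM4_top _).2 ((e γ).trans k)))
      rw [mem_belnap] at hφ
      simp only [eval]
      generalize belnap.eval w γ = a at *
      generalize belnap.eval w φ = b at *
      change chainToDM4 {1, 2} _ true (chainMid {1, 2}) = a ∧
        chainToDM4 {1, 2} _ true (chain3 {1, 2}).falsum = _
      revert a b
      decide
    refine ⟨belnap, W, σ, hW, fun w hw => ?_, w₀, hw₀, _, hh.simulation,
      fun x => hσ x _ w₀ _ hh.simulation (key w₀ hw₀ hn).1 (key w₀ hw₀ hn).2, ?_⟩
    · by_cases hφ : belnap.eval w φ ∈ belnap.designated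
      · have h₁ := (mem_belnap _).1 (hd γ rfl w hw)
        rw [mem_belnap] at hφ
        refine ⟨_, hb, fun x => hσ x _ w _ hb ⟨fun _ => h₁, fun k => absurd k (by decide)⟩
          ⟨fun _ => ?_, fun k => absurd k (by decide)⟩, hbd⟩
        simp [eval, and_fst, h₁, hφ]
      · refine ⟨_, hh.simulation, fun x => hσ x _ w _ hh.simulation (key w hw hφ).1
          (key w hw hφ).2, ?_⟩
        rintro x hx _ rfl
        rw [mem_belnap]
        rw [mem_chainProd] at hx
        revert x
        decide
    · rintro _ rfl
      rw [mem_belnap]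
      rw [mem_chainProd] at hm
      revert m
      decide
  -- The Boolean component of `m` is false, so the second projection separates it; that projection
  -- sends both generators to the top.
  · choose σ hσ using exists_term_chainProd (V := V) .verum .verum
    have hh : IsHom chainProd belnap (fun x => B2ToDM4 _ x.2) := by
      constructor <;> decide
    refine ⟨belnap, W, σ, hW, fun w hw => ⟨_, hb, fun x => hσ x _ w _ hb
      ⟨fun _ => rfl, fun k => absurd k (by decide)⟩ ⟨fun _ => rfl, fun k => absurd k (by decide)⟩,
      hbd⟩, w₀, hw₀, _, hh.simulation, fun x => hσ x _ w₀ _ hh.simulation rfl rfl, ?_⟩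
    rintro _ rfl h
    exact hm₂ ((mem_belnap _).1 h)

/-- In the diamond, `(φ ∧ ¬φ) ∨ (ψ ∧ ¬ψ)` is the top only if `φ` and `ψ` take the two fixpoints, in
either order. So each `w ∈ W` realizes the identity or the swap, and both preserve and reflect the
top. -/
theorem le_ETL (hL : ETL V ≤ L) (h : ¬ ETL₂ V ≤ L) : L ≤ ETL V := by
  have : ∃ φ ψ χ : Formula V, ¬ L.Entails {(φ.and φ.neg).or (ψ.and ψ.neg)} χ := by
    by_contra! k
    refine h (Logic.extend_le hL ?_)
    rintro _ ⟨φ, ψ, χ, rfl⟩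
    exact k φ ψ χ
  obtain ⟨φ, ψ, χ, hφ⟩ := this
  obtain ⟨W, hW, hd, w₀, hw₀, -⟩ := Logic.exists_models hL hφ
  choose σ hσ using exists_term_DM4 {(true, true)} φ ψ
  have key : ∀ w ∈ W, ∃ R, Simulation (DM4 {(true, true)}) (DM4 {(true, true)}) R ∧
      (∀ x, R x ((DM4 {(true, true)}).eval w (σ x))) ∧
      ∀ x z, R x z → (x ∈ (DM4 {(true, true)}).designated ↔
        z ∈ (DM4 {(true, true)}).designated) := fun w hw => by
    have hv := hd _ rfl w hw
    simp only [eval, mem_DM4_top] at hv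
    have : ∀ a b : (DM4 {(true, true)}).Carrier, (DM4 {(true, true)}).or
        ((DM4 {(true, true)}).and a ((DM4 {(true, true)}).neg a))
        ((DM4 {(true, true)}).and b ((DM4 {(true, true)}).neg b)) = (DM4 {(true, true)}).verum →
        (a.1 = true ∧ a.2 = false) ∧ b.1 = false ∧ b.2 = true ∨
        (a.1 = false ∧ a.2 = true) ∧ b.1 = true ∧ b.2 = false := by decide
    obtain ⟨ha, hb⟩ | ⟨ha, hb⟩ := this _ _ hv
    · have hs := (DM4_id_isHom {(true, true)} {(true, true)}).simulation
      refine ⟨_, hs, fun x => hσ x _ w _ hs (Prod.ext ha.1.symm ha.2.symm)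
        (Prod.ext hb.1.symm hb.2.symm), ?_⟩
      rintro x _ rfl
      rfl
    · have hs := (DM4_swap_isHom {(true, true)} {(true, true)}).simulation
      refine ⟨_, hs, fun x => hσ x _ w _ hs (Prod.ext ha.1.symm ha.2.symm)
        (Prod.ext hb.1.symm hb.2.symm), ?_⟩
      rintro x _ rfl
      simp only [mem_DM4_top]
      revert x
      decide
  refine le_log fun m hm => ⟨_, W, σ, hW, fun w hw => ?_, w₀, hw₀, ?_⟩
  · obtain ⟨R, hR, hx, hD⟩ := key w hw
    exact ⟨R, hR, hx, fun x hx z hz => (hD x z hz).1 hx⟩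
  · obtain ⟨R, hR, hx, hD⟩ := key w₀ hw₀
    exact ⟨R, hR, hx, fun z hz => (hD m z hz).not.1 hm⟩

/-- The rules of `BD` together with all rules whose premises are explosive in `BD`. -/
def explosive (V : Type*) : Logic V where
  Entails Γ φ := (BD V).Entails Γ φ ∨ ∃ a, (BD V).Entails Γ (.and a a.neg)
  refl φ := Or.inl ((BD V).refl φ)
  mono Γ Δ φ h := h.imp ((BD V).mono Γ Δ φ) fun ⟨a, ha⟩ => ⟨a, (BD V).mono Γ Δ _ ha⟩
  cut Γ Δ φ h k := by
    by_cases he : ∃ a, (BD V).Entails Γ (.and a a.neg)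
    · exact Or.inr he
    · have h' : ∀ δ ∈ Δ, (BD V).Entails Γ δ := fun δ hδ => (h δ hδ).resolve_right he
      exact k.imp ((BD V).cut Γ Δ φ h') fun ⟨a, ha⟩ => ⟨a, (BD V).cut Γ Δ _ h' ha⟩
  struct Γ φ σ h := h.imp ((BD V).struct Γ φ σ) fun ⟨a, ha⟩ =>
    ⟨a.subst σ, (BD V).struct Γ _ σ ha⟩

theorem ECQ_le_explosive (V : Type*) : ECQ V ≤ explosive V := by
  refine Logic.extend_le (fun Γ φ h => Or.inl h) ?_
  rintro _ ⟨φ, ψ, rfl⟩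
  refine Or.inr ⟨φ, fun w hw => ?_⟩
  have h₁ := hw φ (by simp)
  have h₂ := hw φ.neg (by simp)
  rw [mem_belnap] at *
  simp [eval, and_fst] at *
  exact ⟨h₁, h₂⟩

/-- The failing rule holds in `ECQ` but not in `BD`, so its premises yield some `a ∧ ¬a` in `BD`,
and `a` names `b` throughout `W`. As the rule holds in `LP`, an atom names `n` at `w₀`; elsewhere
its value is not constrained and bounds suffice. -/
theorem le_BD (hL : BD V ≤ L) (h : ¬ LP V ⊓ ECQ V ≤ L) : L ≤ BD V := by
  obtain ⟨Γ, φ, ⟨hΓ, hΓ'⟩, hφ⟩ := Logic.not_le h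
  obtain ⟨a, ha⟩ := (ECQ_le_explosive V Γ φ hΓ').resolve_left fun k => hφ (hL _ _ k)
  obtain ⟨W, hW, hd, w₀, hw₀, hn⟩ := Logic.exists_models hL hφ
  obtain ⟨q, hq⟩ := exists_atom_of_LP hΓ (fun γ hγ => hd γ hγ _ hw₀) hn
  have key : ∀ w ∈ W, ((true, false) : Bool × Bool) = belnap.eval w a := fun w hw => by
    have h := ha w fun γ hγ => hd γ hγ _ hw
    rw [mem_belnap] at h
    simp only [eval, and_fst, neg_fst, Bool.and_eq_true, Bool.not_eq_true'] at h
    exact Prod.ext h.1.symm h.2.symm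
  choose σ hσ using exists_term_DM4 {(true, true), (true, false)} a (.atom q)
  have hb : Simulation belnap belnap _ := simulation_bounds _
    (fun x : belnap.Carrier => x.1 = true) (fun x : belnap.Carrier => x.2 = false) (by decide) (by decide)
    (by decide) (by decide) (by decide) (by decide) (by decide) (by decide)
  have hs := (DM4_id_isHom {(true, true), (true, false)} {(true, true), (true, false)}).simulation
  refine le_log fun m hm => ⟨belnap, W, σ, hW,
    fun w hw => ⟨_, hb, fun x => hσ x _ w _ hb ?_ ?_, fun x hx z hz =>
      (mem_belnap z).2 (hz.1 ((mem_belnap x).1 hx))⟩,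
    w₀, hw₀, _, hs, fun x => hσ x _ w₀ _ hs (key w₀ hw₀) hq.symm, ?_⟩
  · rw [← key w hw]
    exact ⟨fun _ => rfl, fun _ => rfl⟩
  · exact ⟨fun k => absurd k (by decide), fun k => absurd k (by decide)⟩
  · rintro _ rfl
    exact hm

end Models

variable {L : Logic V}

/-! ### The dichotomy between `KO` and `Kminus` -/

section LowerBoundK

/-- The disjunction of `φ` with the contradictions `p ∧ ¬p` for the atoms `p` in a list. -/
def Formula.orContradictions (φ : Formula V) (l : List V) : Formula V :=
  l.foldr (fun p ψ => ((Formula.atom p).and (Formula.atom p).neg).or ψ) φ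

theorem orContradictions_fst (w : V → belnap.Carrier) (φ : Formula V) (l : List V) :
    (belnap.eval w (φ.orContradictions l)).1 = true ↔
      (∃ p ∈ l, w p = (true, false)) ∨ (belnap.eval w φ).1 = true := by
  induction l with
  | nil => simp [Formula.orContradictions]
  | cons p l ih =>
    have : ((w p).1 && !(w p).2) = true ↔ w p = (true, false) := by
      generalize w p = a
      revert a
      exact (by decide : ∀ a : Bool × Bool, (a.1 && !a.2) = true ↔ a = (true, false))
    change (((w p).1 && !(w p).2) || (belnap.eval w (φ.orContradictions l)).1) = true ↔ _
    rw [Bool.or_eq_true, this, ih]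
    simp [or_assoc]

/-- Otherwise `(a ∧ ¬a) ∨ r` could always be weakened to `(q ∨ ¬q) ∨ r` over `W`. By
`exists_atom_of_K`, `W` validates the disjunction of `φ` with the contradictions in the finitely
many relevant atoms. Replacing these one at a time gives `(q ∨ ¬q) ∨ φ`, which fails at `w₀` when
`q` is an atom with value `n` there. -/
theorem exists_models_of_not_KO_le (hL : BD V ≤ L) (h : ¬ KO V ≤ L) :
    ∃ (a q r : Formula V) (W : _), L.Models belnap W ∧
      (∀ w ∈ W, (belnap.eval w ((a.and a.neg).or r)).1 = true) ∧
      ∃ w ∈ W, ¬ (belnap.eval w ((q.or q.neg).or r)).1 = true := by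
  obtain ⟨Γ, φ, ⟨hΓ, hΓ'⟩, hφ⟩ := Logic.not_le h
  obtain ⟨γ, hγ, hγφ⟩ := exists_premise (BD_le_K V) hΓ'
  obtain ⟨W, hW, hd, w₀, hw₀, hn⟩ := Logic.exists_models hL hφ
  by_contra! hc
  have key : ∀ (q : V) (l : List V) (r : Formula V),
      (∀ w ∈ W, (belnap.eval w (r.orContradictions l)).1 = true) →
      ∀ w ∈ W, (belnap.eval w (((Formula.atom q).or (Formula.atom q).neg).or r)).1 = true := by
    intro q l
    induction l with
    | nil =>
      intro r hr w hw
      have := hr w hw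
      simp only [Formula.orContradictions, List.foldr_nil] at this
      simp [eval, or_fst, this]
    | cons p l ih =>
      intro r hr w hw
      have h₁ := hc (.atom p) (.atom q) (r.orContradictions l) W hW hr
      -- The new disjunct `q ∨ ¬q` is absorbed into `r`, which is why the induction quantifies over
      -- `r`.
      have h₂ := ih (((Formula.atom q).or (Formula.atom q).neg).or r) (fun w hw => by
        have := h₁ w hw
        rw [orContradictions_fst]
        simp only [eval, or_fst, Bool.or_eq_true] at this ⊢
        rw [orContradictions_fst] at this
        exact or_left_comm.1 this) w hw
      simp only [eval, or_fst, Bool.or_eq_true] at h₂ ⊢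
      tauto
  obtain ⟨q, hq⟩ := exists_atom_of_LP hΓ (fun γ hγ => hd γ hγ _ hw₀) hn
  have := key q (γ.atoms ++ φ.atoms) φ (fun w hw => by
    rw [orContradictions_fst, ← mem_belnap]
    by_contra! k
    obtain ⟨p, hp, hp'⟩ := exists_atom_of_K hγφ (hγ w fun γ hγ => hd γ hγ w hw) k.2
    exact k.1 p hp hp') w₀ hw₀
  rw [mem_belnap] at hn
  simp [eval, or_fst, hq, hn] at this
  exact absurd this (by decide)

/-- To separate `(1, 2)`, `a ∧ ¬a` and `(q ∨ ¬q) ∨ r` name the generators `(2, 0)` and `(1, 2)`: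
where the second formula is undesignated their values are `b` and `n`, the images under `M8ToDM4`.
All other undesignated values are separated through the chain, as in `le_K`. -/
theorem le_Kminus (hL : BD V ≤ L) (h : ¬ KO V ≤ L) : L ≤ Kminus V := by
  have hb : Simulation M8 belnap _ := simulation_bounds _
    (fun x : M8.Carrier => x.1.2 = 2) (fun x : M8.Carrier => x.1.1 = 0) (by decide) (by decide)
    (by decide) (by decide) (by decide) (by decide) (by decide) (by decide)
  have hbd : ∀ x ∈ M8.designated, ∀ z : belnap.Carrier,
      (x.1.2 = 2 → z.1 = true) ∧ (x.1.1 = 0 → z.2 = false) → z ∈ belnap.designated :=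
    fun x hx z hz => (mem_belnap z).2 (hz.1 (by rw [(mem_M8 x).1 hx]; rfl))
  refine le_log fun m hm => ?_
  by_cases hm₂ : m.1.2 = 2
  · obtain ⟨a, q, r, W, hW, hd, w₀, hw₀, hn⟩ := exists_models_of_not_KO_le hL h
    have hh := (M8ToDM4_isHom {(true, true), (true, false)}).simulation
    choose σ hσ using exists_term_M8 (a.and a.neg) ((q.or q.neg).or r)
    have key : ∀ w ∈ W, ¬ (belnap.eval w ((q.or q.neg).or r)).1 = true →
        M8ToDM4 {(true, true), (true, false)} ⟨(2, 0), by decide⟩ =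
          belnap.eval w (a.and a.neg) ∧
        M8ToDM4 {(true, true), (true, false)} ⟨(1, 2), by decide⟩ =
          belnap.eval w ((q.or q.neg).or r) := fun w hw h => by
      have := hd w hw
      simp only [eval] at this h ⊢
      generalize belnap.eval w a = α at *
      generalize belnap.eval w q = β at *
      generalize belnap.eval w r = ρ at *
      clear hσ hh hbd hb hd hn hW
      revert α β ρ
      decide
    refine ⟨belnap, W, σ, hW, fun w hw => ?_, w₀, hw₀, _, hh,
      fun x => hσ x _ w₀ _ hh (key w₀ hw₀ hn).1 (key w₀ hw₀ hn).2, ?_⟩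
    · by_cases hw' : (belnap.eval w ((q.or q.neg).or r)).1 = true
      · exact ⟨_, hb, fun x => hσ x _ w _ hb
          ⟨fun k => absurd k (by decide), fun k => absurd k (by decide)⟩
          ⟨fun _ => hw', fun k => absurd k (by decide)⟩, hbd⟩
      · refine ⟨_, hh, fun x => hσ x _ w _ hh (key w hw hw').1 (key w hw hw').2, ?_⟩
        rintro x hx _ rfl
        rw [mem_belnap]
        rw [mem_M8] at hx
        revert x
        decide
    · rintro _ rfl
      rw [mem_belnap]
      rw [mem_M8] at hm
      revert m
      decide
  · obtain ⟨W, hW, w₀, hw₀, p, hp⟩ := exists_models_of_not_LP_le hL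
      (fun k => h (inf_le_left.trans k))
    have hh : IsHom M8 belnap (fun x => chainToDM4 {2} _ false (M8ToChain {2} x)) := by
      constructor <;> decide
    choose σ hσ using exists_term_M8 (.atom p) .verum
    refine ⟨belnap, W, σ, hW, fun w hw => ⟨_, hb, fun x => hσ x _ w _ hb
      ⟨fun k => absurd k (by decide), fun k => absurd k (by decide)⟩
      ⟨fun _ => rfl, fun k => absurd k (by decide)⟩, hbd⟩,
      w₀, hw₀, _, hh.simulation, fun x => hσ x _ w₀ _ hh.simulation ?_ ?_, ?_⟩
    · exact hp.symm
    · rfl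
    · rintro _ rfl
      rw [mem_belnap]
      clear hm
      revert m
      decide

end LowerBoundK

/-! ### Recovering a logic from its intersection with `LP` -/

section ModusPonens

/-- If `γ ⊢ φ` holds in `M.log V`, then `γ ⊢ ¬γ ∨ φ` holds there and also in `LP`, because `γ ⊢ φ`
is classically valid. Hence it holds in `L`, and `ETL` detaches `φ`. -/
theorem log_le_of_ETL_le {M : LogicalMatrix} [Finite M.Carrier] (hM : BD V ≤ M.log V)
    (hM' : M.log V ≤ CL V) (h : ETL V ≤ L) (h' : LP V ⊓ M.log V ≤ L) : M.log V ≤ L := by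
  intro Γ φ hΓ
  obtain ⟨γ, hγ, hγφ⟩ := exists_premise hM hΓ
  refine Logic.entails_of_premise ((BD_le_ETL V).trans h) hγ ?_
  have h₁ : L.Entails {γ} (γ.neg.or φ) := by
    refine h' _ _ ⟨fun v hv => ?_, ?_⟩
    · have h₂ := hv γ rfl
      have h₃ : ∀ u : V → B2.Carrier, B2.eval u γ = B2.verum → B2.eval u φ = B2.verum :=
        fun u hu => hM' _ _ hγφ u (by rintro _ rfl; exact hu)
      have hs := B2_chain_simulation {1, 2}
      -- Resolving the middle value to true gives a classical valuation which agrees with `v` on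
      -- every formula with value `0` or `2`.
      have h₄ := hs.eval (v := fun p => if v p = (chain3 {1, 2}).falsum then B2.falsum
        else B2.verum) (w := v) (fun p => by
          generalize v p = x
          revert x
          decide)
      have hγ' := h₄ γ
      have hφ' := h₄ φ
      have h₅ := h₃ fun p => if v p = (chain3 {1, 2}).falsum then B2.falsum else B2.verum
      rw [mem_chain3_one] at h₂ ⊢
      simp only [eval] at h₂ ⊢
      generalize B2.eval _ γ = a at *
      generalize B2.eval _ φ = b at *
      generalize (chain3 {1, 2}).eval v γ = x at *
      generalize (chain3 {1, 2}).eval v φ = y at *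
      clear h₄ h₃ hv hs hγφ hγ
      revert a b x y
      decide
    · refine (M.log V).cut _ {φ} _ (by rintro _ rfl; exact hγφ) (hM _ _ fun w hw => ?_)
      have := (mem_belnap _).1 (hw φ rfl)
      simp [mem_belnap, eval, or_fst, this]
  refine L.cut {γ} {γ, γ.neg.or φ} φ ?_ (h _ _ fun v hv => ?_)
  · rintro δ (rfl | rfl)
    · exact L.refl _
    · exact h₁
  · have h₂ := (mem_DM4_top _).1 (hv γ (by simp))
    have h₃ := (mem_DM4_top _).1 (hv (γ.neg.or φ) (by simp))
    rw [mem_DM4_top]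
    simp only [eval] at h₃
    rw [h₂] at h₃
    generalize (DM4 {(true, true)}).eval v φ = y at *
    revert y
    decide

end ModusPonens

/-! ### Classically unsatisfiable premises and joins with `ECQ` -/

section Explosion

theorem K_explosive {γ : Formula V} (h : (CL V).Entails {γ} .falsum) (v : V → (chain3 {2}).Carrier) :
    (chain3 {2}).eval v γ ≠ (chain3 {2}).verum := by
  intro hv
  have hs := (B2_chain_simulation {2}).eval (v := fun p => if v p = (chain3 {2}).falsum
    then B2.falsum else B2.verum) (w := v) (fun p => by
      generalize v p = x
      revert x
      decide) γ
  have h₂ := h (fun p => if v p = (chain3 {2}).falsum then B2.falsum else B2.verum)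
  simp only [Set.mem_singleton_iff, forall_eq, mem_B2, eval] at h₂
  generalize B2.eval _ γ = a at *
  generalize (chain3 {2}).eval v γ = x at *
  clear h
  revert a x
  decide

theorem K_entails_of_explosive {γ : Formula V} (h : (CL V).Entails {γ} .falsum) (φ : Formula V) :
    (K V).Entails {γ} φ := fun v hv =>
  absurd (hv γ rfl) (K_explosive h v)

theorem Kminus_entails_of_explosive {γ : Formula V} (h : (CL V).Entails {γ} .falsum)
    (φ : Formula V) : (Kminus V).Entails {γ} φ := fun v hv => by
  refine absurd ?_ (K_explosive h fun p => M8ToChain {2} (v p))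
  rw [(M8ToChain_isHom {2}).eval, (mem_M8 _).1 (hv γ rfl)]
  rfl

theorem CL_entails_of_explosive {γ : Formula V} (h : (CL V).Entails {γ} .falsum)
    (φ : Formula V) : (CL V).Entails {γ} φ := fun v hv =>
  absurd ((mem_B2 _).1 (h v hv)) (by simp only [eval]; decide)

/-- If the premises are classically unsatisfiable, they reduce to one `γ` from which `LP ⊓ N`
derives `¬γ`, and `ECQ` finishes. Otherwise fix a classical valuation `u` satisfying them; pairing
it with any valuation for `LP` shows that the rule already holds in `LP`. -/
theorem LPCL_inf_le {N : Logic V}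
    (hN : ∀ γ, (CL V).Entails {γ} .falsum → ∀ φ, N.Entails {γ} φ) :
    LPCL V ⊓ N ≤ LP V ⊓ N ⊔ ECQ V := by
  rintro Γ φ ⟨h, hΓ⟩
  by_cases hc : (CL V).Entails Γ .falsum
  · obtain ⟨γ, hγ, hγ'⟩ := exists_premise (M := B2) (BD_le_CL V) hc
    refine Logic.entails_of_premise ((BD_le_ECQ V).trans le_sup_right) hγ ?_
    refine Logic.cut _ {γ} {γ, γ.neg} φ ?_
      ((le_sup_right : ECQ V ≤ LP V ⊓ N ⊔ ECQ V) _ _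
        (Logic.extend_rule (BD V) (r := ({γ, γ.neg}, φ)) ⟨γ, φ, rfl⟩))
    rintro δ (rfl | rfl)
    · exact Logic.refl _ _
    · refine (le_sup_left : LP V ⊓ N ≤ LP V ⊓ N ⊔ ECQ V) _ _ ⟨fun v hv => ?_, hN γ hγ' _⟩
      have h₁ : (chain3 {1, 2}).eval v γ ≠ (chain3 {1, 2}).verum := fun k =>
        K_explosive hγ' v (((chain3_id_isHom {1, 2} {2}).eval v γ).trans k)
      rw [mem_chain3_one]
      simp only [eval]
      generalize (chain3 {1, 2}).eval v γ = x at *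
      revert x
      decide
  · refine (le_sup_left : LP V ⊓ N ≤ LP V ⊓ N ⊔ ECQ V) _ _ ⟨fun v hv => ?_, hΓ⟩
    have : ∃ u : V → B2.Carrier, ∀ γ ∈ Γ, B2.eval u γ ∈ B2.designated := by
      by_contra! k
      refine hc fun u hu => ?_
      obtain ⟨γ, hγ, hγ'⟩ := k u
      exact absurd (hu γ hγ) hγ'
    obtain ⟨u, hu⟩ := this
    have h₁ : ∀ ψ, (chain3 {1, 2}).eval v ψ = (chainProd.eval (fun p => (v p, u p)) ψ).1 :=
      (chainProd_fst_isHom {1, 2}).eval fun p => ((v p, u p) : Fin 3 × Bool)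
    have h₂ : ∀ ψ, B2.eval u ψ = (chainProd.eval (fun p => (v p, u p)) ψ).2 :=
      chainProd_snd_isHom.eval fun p => ((v p, u p) : Fin 3 × Bool)
    have h₃ := h (fun p => (v p, u p)) fun γ hγ =>
      ⟨(h₁ γ).symm ▸ (mem_chain3_one _).1 (hv γ hγ), (h₂ γ).symm ▸ hu γ hγ⟩
    rw [mem_chain3_one, h₁]
    exact h₃.1

end Explosion

/-! ### Three-element intervals and the extensions of `ETL` -/

theorem sup_ECQ_le_LPCL (N : Logic V) : LP V ⊓ N ⊔ ECQ V ≤ LPCL V :=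
  sup_le (inf_le_left.trans (LP_le_LPCL V)) (ECQ_le_LPCL V)

/-- The interval between `LP ⊓ N` and `N`, for a finitary explosive logic `N` above `ETL`. -/
theorem interval_LP_inf [Infinite V] {M : LogicalMatrix} [Finite M.Carrier] (hM : ETL V ≤ M.log V)
    (hM' : M.log V ≤ CL V)
    (he : ∀ γ, (CL V).Entails {γ} .falsum → ∀ φ, (M.log V).Entails {γ} φ) :
    LP V ⊓ M.log V < LP V ⊓ M.log V ⊔ ECQ V ∧ LP V ⊓ M.log V ⊔ ECQ V < M.log V ∧
      Set.Icc (LP V ⊓ M.log V) (M.log V) =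
        {LP V ⊓ M.log V, LP V ⊓ M.log V ⊔ ECQ V, M.log V} := by
  have hBD : BD V ≤ M.log V := (BD_le_ETL V).trans hM
  have h₁ : LP V ⊓ M.log V < LP V ⊓ M.log V ⊔ ECQ V := left_lt_sup.2 fun h =>
    not_ECQ_le_LP V (h.trans inf_le_left)
  have h₂ : LP V ⊓ M.log V ⊔ ECQ V ≤ M.log V :=
    sup_le inf_le_right ((ECQ_le_ETL V).trans hM)
  have h₃ : LP V ⊓ M.log V ⊔ ECQ V < M.log V := lt_of_le_not_ge h₂ fun h =>
    not_ETL_le_LPCL V (hM.trans (h.trans (sup_ECQ_le_LPCL _)))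
  refine ⟨h₁, h₃, Set.Subset.antisymm ?_ ?_⟩
  · rintro L ⟨hL, hL'⟩
    have hBL : BD V ≤ L := (le_inf (BD_le_LP V) hBD).trans hL
    -- Whether `L` contains `ECQ`, and then `ETL`, decides which of the three logics it is.
    by_cases hE : ECQ V ≤ L
    · by_cases hT : ETL V ≤ L
      · exact Or.inr (Or.inr (le_antisymm hL' (log_le_of_ETL_le hBD hM' hT hL)))
      · exact Or.inr (Or.inl (le_antisymm
          ((le_inf (le_LPCL hBL hT) hL').trans (LPCL_inf_le he)) (sup_le hL hE)))
    · exact Or.inl (le_antisymm (le_inf (le_LP hBL hE) hL') hL)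
  · rintro L (rfl | rfl | rfl)
    · exact ⟨le_rfl, inf_le_right⟩
    · exact ⟨le_sup_left, h₂⟩
    · exact ⟨inf_le_right, le_rfl⟩

instance : Finite M8.Carrier := Finite.of_fintype _

/-- If `KO ≤ L`, detachment gives `K ≤ L`; then `LP ≤ L` forces `CL`, and otherwise `le_K` forces
`K`. -/
theorem mem_Icc_of_ETL_le {L : Logic V} (hL : ETL V ≤ L) (h₁ : L ≠ ⊤) (h₂ : L ≠ ETL V)
    (h₃ : L ≠ K V) (h₄ : L ≠ CL V) : L ∈ Set.Icc (ETL₂ V) (Kminus V) := by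
  have hB := (BD_le_ETL V).trans hL
  refine ⟨?_, ?_⟩
  · by_contra h
    exact h₂ (le_antisymm (le_ETL hL h) hL)
  · refine le_Kminus hB fun h => ?_
    have hK : K V ≤ L := log_le_of_ETL_le (BD_le_K V) (K_le_CL V) hL h
    by_cases hLP : LP V ≤ L
    · exact h₄ (le_antisymm (le_CL hB h₁)
        (log_le_of_ETL_le (BD_le_CL V) le_rfl hL (inf_le_left.trans hLP)))
    · exact h₃ (le_antisymm (le_K hB hLP) hK)

end Extensions

end SuperBelnap

/-! ### Assembly of the intervals -/

open SuperBelnap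
theorem mainTheorem5 (V : Type*) [Infinite V] :
    -- the structure of the lattice of extensions of `ETL`
    (ETL V < ETL₂ V ∧ ETL₂ V ≤ Kminus V ∧ Kminus V < K V ∧ K V < CL V ∧ CL V < ⊤) ∧
    (∀ L : Logic V, ETL V ≤ L → L ≠ ⊤ → L ≠ ETL V → L ≠ K V → L ≠ CL V →
      L ∈ Set.Icc (ETL₂ V) (Kminus V)) ∧
    Set.Icc (ETL V) (CL V) = {ETL V} ∪ Set.Icc (ETL₂ V) (Kminus V) ∪ {K V, CL V} ∧
    -- the unique cover of `ETL`, and the unique lower cover of `K` among the extensions of `ETL`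
    (∀ L : Logic V, ETL V ⋖ L ↔ L = ETL₂ V) ∧
    (∀ L ∈ Set.Icc (ETL V) (CL V), L ⋖ K V ↔ L = Kminus V) ∧
    -- the upper part of the lattice of extensions of `BD`
    (Set.Icc (KOminus V) (CL V) =
        Set.Icc (LP V) (CL V) ∪ Set.Icc (KO V) (K V) ∪ Set.Icc (KOminus V) (Kminus V) ∧
      [Set.Icc (LP V) (CL V), Set.Icc (KO V) (K V),
        Set.Icc (KOminus V) (Kminus V)].Pairwise Disjoint) ∧
    (LP V < LP V ⊔ ECQ V ∧ LP V ⊔ ECQ V < CL V ∧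
      Set.Icc (LP V) (CL V) = {LP V, LP V ⊔ ECQ V, CL V}) ∧
    (KO V < KO V ⊔ ECQ V ∧ KO V ⊔ ECQ V < K V ∧
      Set.Icc (KO V) (K V) = {KO V, KO V ⊔ ECQ V, K V}) ∧
    (KOminus V < KOminus V ⊔ ECQ V ∧ KOminus V ⊔ ECQ V < Kminus V ∧
      Set.Icc (KOminus V) (Kminus V) = {KOminus V, KOminus V ⊔ ECQ V, Kminus V}) ∧
    -- the lower part of the lattice of extensions of `BD`
    (∀ L : Logic V, BD V < L → L ≠ ⊤ →
      L ∈ Set.Icc (KO V) (CL V) ∪ Set.Icc (LP V ⊓ ECQ V) (KOminus V) ∪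
        Set.Icc (ECQ V) (KOminus V ⊔ ECQ V) ∪ Set.Icc (ETL V) (Kminus V)) ∧
    [Set.Icc (KO V) (CL V), Set.Icc (LP V ⊓ ECQ V) (KOminus V),
      Set.Icc (ECQ V) (KOminus V ⊔ ECQ V), Set.Icc (ETL V) (Kminus V)].Pairwise Disjoint := by
  have e₁ : ETL V < ETL₂ V := lt_of_le_not_ge (Logic.le_extend _ _) (not_ETL₂_le_ETL V)
  have e₂ := ETL₂_le_Kminus V
  have e₃ : Kminus V < K V := lt_of_le_not_ge (Kminus_le_K V) fun h =>
    not_KO_le_Kminus V (inf_le_right.trans h)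
  have e₄ : K V < CL V := lt_of_le_not_ge (K_le_CL V) fun h =>
    not_LP_le_K V ((LP_le_CL V).trans h)
  have e₅ : CL V < ⊤ := lt_top_iff_ne_top.2 (CL_ne_top V)
  have hETL : ∀ L : Logic V, ETL V ≤ L → L ≠ ⊤ → L ≠ ETL V → L ≠ K V → L ≠ CL V →
      L ∈ Set.Icc (ETL₂ V) (Kminus V) := fun L h h₁ h₂ h₃ h₄ => mem_Icc_of_ETL_le h h₁ h₂ h₃ h₄
  have hcover : ∀ L : Logic V, ETL V < L → ETL₂ V ≤ L := fun L hL => by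
    by_contra h
    exact hL.not_ge (le_ETL hL.le h)
  have hLK : ∀ L : Logic V, ETL V ≤ L → L < K V → L ≤ Kminus V := fun L hL h => by
    by_cases h' : L = ETL V
    · exact h' ▸ ETL_le_Kminus V
    · exact (hETL L hL ((h.trans e₄).trans e₅).ne h' h.ne (h.trans e₄).ne).2
  have hKO : KOminus V ≤ KO V := inf_le_inf_left _ e₃.le
  have hsup : KOminus V ⊔ ECQ V ≤ Kminus V := sup_le inf_le_right (ECQ_le_Kminus V)
  have hLPCL : LP V ⊓ CL V = LP V := inf_eq_left.2 (LP_le_CL V)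
  have disj : ∀ {a b c d : Logic V}, ¬ a ≤ d → Disjoint (Set.Icc a b) (Set.Icc c d) :=
    fun h => Set.disjoint_left.2 fun x hx hx' => h (hx.1.trans hx'.2)
  have disj' : ∀ {a b c d : Logic V}, ¬ c ≤ b → Disjoint (Set.Icc a b) (Set.Icc c d) :=
    fun h => (disj h).symm
  refine ⟨⟨e₁, e₂, e₃, e₄, e₅⟩, hETL, ?_, ?_, ?_, ⟨?_, ?_⟩, ?_, ?_, ?_, ?_, ?_⟩
  · ext L
    simp only [Set.mem_union, Set.mem_singleton_iff, Set.mem_insert_iff]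
    constructor
    · rintro ⟨h, h'⟩
      by_contra! k
      exact k.1.2 (hETL L h (h'.trans_lt e₅).ne k.1.1 k.2.1 k.2.2)
    · rintro ((rfl | h) | rfl | rfl)
      · exact ⟨le_rfl, (e₁.le.trans e₂).trans (e₃.trans e₄).le⟩
      · exact ⟨e₁.le.trans h.1, h.2.trans (e₃.trans e₄).le⟩
      · exact ⟨(e₁.le.trans e₂).trans e₃.le, e₄.le⟩
      · exact ⟨(e₁.le.trans e₂).trans (e₃.trans e₄).le, le_rfl⟩
  · refine fun L => ⟨fun h => ?_, ?_⟩
    · exact ((hcover L h.lt).eq_of_not_lt fun k => h.2 e₁ k).symm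
    · rintro rfl
      exact ⟨e₁, fun L h h' => h'.not_ge (hcover L h)⟩
  · rintro L ⟨hL, -⟩
    refine ⟨fun h => (hLK L hL h.lt).eq_of_not_lt fun k => h.2 k e₃, ?_⟩
    rintro rfl
    exact ⟨e₃, fun L' h h' => h.not_ge (hLK L' (hL.trans h.le) h')⟩
  · ext L
    simp only [Set.mem_union]
    constructor
    · rintro ⟨h, h'⟩
      have hB := (BD_le_KOminus V).trans h
      by_cases h₁ : LP V ≤ L
      · exact Or.inl (Or.inl ⟨h₁, h'⟩)
      · by_cases h₂ : KO V ≤ L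
        · exact Or.inl (Or.inr ⟨h₂, le_K hB h₁⟩)
        · exact Or.inr ⟨h, le_Kminus hB h₂⟩
    · rintro ((h | h) | h)
      · exact ⟨inf_le_left.trans h.1, h.2⟩
      · exact ⟨hKO.trans h.1, h.2.trans e₄.le⟩
      · exact ⟨h.1, h.2.trans (e₃.trans e₄).le⟩
  · simp only [List.pairwise_cons, List.mem_cons, List.not_mem_nil, or_false, forall_eq_or_imp,
      forall_eq, List.Pairwise.nil, and_true, false_implies, implies_true]
    exact ⟨⟨disj (not_LP_le_K V), disj fun h => not_LP_le_K V (h.trans e₃.le)⟩,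
      disj (not_KO_le_Kminus V)⟩
  · have := interval_LP_inf (V := V) (M := LogicalMatrix.B2)
      ((ETL_le_Kminus V).trans (e₃.trans e₄).le) le_rfl fun γ h => CL_entails_of_explosive h
    change LP V ⊓ CL V < LP V ⊓ CL V ⊔ ECQ V ∧ LP V ⊓ CL V ⊔ ECQ V < CL V ∧
      Set.Icc (LP V ⊓ CL V) (CL V) = {LP V ⊓ CL V, LP V ⊓ CL V ⊔ ECQ V, CL V} at this
    rwa [hLPCL] at this
  · exact interval_LP_inf ((ETL_le_Kminus V).trans e₃.le) (K_le_CL V)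
      fun γ h => K_entails_of_explosive h
  · exact interval_LP_inf (ETL_le_Kminus V) (e₃.trans e₄).le
      fun γ h => Kminus_entails_of_explosive h
  · intro L hL hT
    simp only [Set.mem_union]
    -- A proper extension of `BD` contains `LP ⊓ ECQ`; testing for `KO`, `ETL` and `ECQ` in turn
    -- then selects the interval.
    have hE : LP V ⊓ ECQ V ≤ L := by
      by_contra h
      exact hL.not_ge (le_BD hL.le h)
    by_cases h₁ : KO V ≤ L
    · exact Or.inl (Or.inl (Or.inl ⟨h₁, le_CL hL.le hT⟩))
    have h₂ := le_Kminus hL.le h₁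
    by_cases h₃ : ETL V ≤ L
    · exact Or.inr ⟨h₃, h₂⟩
    by_cases h₄ : ECQ V ≤ L
    · exact Or.inl (Or.inr ⟨h₄, (le_inf (le_LPCL hL.le h₃) h₂).trans
        (LPCL_inf_le fun γ h => Kminus_entails_of_explosive h)⟩)
    · exact Or.inl (Or.inl (Or.inr ⟨hE, le_inf (le_LP hL.le h₄) h₂⟩))
  · have h₁ : ¬ KO V ≤ KOminus V ⊔ ECQ V := fun h => not_KO_le_Kminus V (h.trans hsup)
    have h₂ : ¬ ECQ V ≤ KOminus V := fun h => not_ECQ_le_LP V (h.trans inf_le_left)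
    simp only [List.pairwise_cons, List.mem_cons, List.not_mem_nil, or_false, forall_eq_or_imp,
      forall_eq, List.Pairwise.nil, and_true, false_implies, implies_true]
    exact ⟨⟨disj fun h => h₁ (h.trans le_sup_left), disj h₁, disj (not_KO_le_Kminus V)⟩,
      ⟨disj' h₂, disj' fun h => h₂ ((ECQ_le_ETL V).trans h)⟩,
      disj' fun h => not_ETL_le_LPCL V (h.trans (sup_ECQ_le_LPCL _))⟩
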